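/- Let $1<p<\infty$ and let $X=(X,d,\mu)$ be a proper metric measure space (all closed bounded sets are compact), where $\mu$ is a (completed) Borel measure with $0<\mu(B)<\infty$ for all balls $B$. Assume that $X$ supports a $(p,p)$-Poincaré inequality: there are constants $C>0$ and $\lambda\ge1$ such that $$\Bigl(\frac1{\mu(B)}\int_B|w-w_B|^p\,d\mu\Bigr)^{1/p}\le C\,\operatorname{diam}(B)\Bigl(\frac1{\mu(\lambda B)}\int_{\lambda B}g^p\,d\mu\Bigr)^{1/p}$$ for all balls $B$, all integrable functions $w$ on $X$ (with mean value $w_B=\frac1{\mu(B)}\int_B w\,d\mu$) and all upper gradients $g$ of $w$. For an open set $V\subset X$, let $D^p(V)$ be the space of everywhere defined measurable functions $v\colon V\to[-\infty,\infty]$ that have an upper gradient in $L^p(V)$; let $g_v$ denote the minimal $p$-weak upper gradient of $v$ in $V$; and let $N^{1,p}(V)$ be the space of all functions $v$ that locally belong to $D^p$ in $V$ and satisfy $\|v\|_{N^{1,p}(V)}=\bigl(\int_V|v|^p\,d\mu+\int_V g_v^p\,d\mu\bigr)^{1/p}<\infty$. Let $D^p_0(V)$ and $N^{1,p}_0(V)$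 be the spaces of restrictions to $V$ of functions in $D^p(X)$ and $N^{1,p}(X)$, respectively, that vanish on $X\setminus V$. The capacity of $E\subset X$ is $C_p(E)=\inf\|w\|_{N^{1,p}(X)}^p$ over all $w\in N^{1,p}(X)$ with $w\ge1$ on $E$, and "q.e." means outside a set of capacity zero. For a nonempty open set $V\subset X$ with $C_p(X\setminus V)>0$, a function $\psi\colon V\to[-\infty,\infty]$ and $f\in D^p(V)$, let $$\mathcal K_{\psi,f}(V)=\{v\in D^p(V):v-f\in D^p_0(V)\text{ and }v\ge\psi\text{ q.e. in }V\}.$$ A function $u$ is a solution of the $\mathcal K_{\psi,f}(V)$-obstacle problem if $u\in\mathcal K_{\psi,f}(V)$ and $\int_Vg_u^p\,d\mu\le\int_Vg_v^p\,d\mu$ for all $v\in\mathcal K_{\psi,f}(V)$. If $V$ is moreover bounded and $f\in N^{1,p}(V)$, then $\mathcal K^B_{\psi,f}(V)$ and solutions of the $\mathcal K^B_{\psi,f}(V)$-obstacle problem are defined in the same way, with $N^{1,p}(V)$ and $N^{1,p}_0(V)$ in place of $D^p(V)$ and $D^p_0(V)$. **Proposition.** Let $\Omega\subset X$ be a nonempty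 open set with $C_p(X\setminus\Omega)>0$, let $\psi\colon\Omega\to[-\infty,\infty]$ and $f\in D^p(\Omega)$, and let $u$ be a solution of the $\mathcal K_{\psi,f}(\Omega)$-obstacle problem. Let $\Omega'$ be a nonempty open subset of $\Omega$. Then $u$ (restricted to $\Omega'$) is a solution of the $\mathcal K_{\psi,u}(\Omega')$-obstacle problem. Moreover, if $\overline{\Omega'}$ is a compact subset of $\Omega$, then $u$ is also a solution of the $\mathcal K^B_{\psi,u}(\Omega')$-obstacle problem. -/

import Mathlib

open MeasureTheory Set Metric
open scoped ENNReal

noncomputable section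

namespace MetricObstacle

/-! Functions on a subset `E` of `X` are represented by functions on all of `X`; every notion
"on `E`" below only looks at the values on `E`, and at curves that stay in `E`, so that it is the
notion for `E` as a metric measure space in its own right, with measure `μ.restrict E`
(the sets `E` used are open, or all of `X`).
Functions that are measurable with respect to the completion of the Borel `σ`-algebra are those
that are `AEMeasurable`. -/

/-- A nonconstant rectifiable curve, parametrized by arc length on `[0, length]`
(values of `toFun` outside this interval are irrelevant). -/
structure Curve (X : Type*) [MetricSpace X] where
  length : ℝ
  length_pos : 0 < length
  toFun : ℝ → X
  unitSpeed : HasUnitSpeedOn toFun (Icc 0 length)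

/-- The curve `γ` stays in `E`. -/
def Curve.InSet {X : Type*} [MetricSpace X] (γ : Curve X) (E : Set X) : Prop :=
  ∀ t ∈ Icc 0 γ.length, γ.toFun t ∈ E

/-- The curve integral `∫_γ g ds`. -/
def Curve.integral {X : Type*} [MetricSpace X] (γ : Curve X) (g : X → ℝ≥0∞) : ℝ≥0∞ :=
  ∫⁻ t in Icc 0 γ.length, g (γ.toFun t)

/-- `|f(x) - f(y)| ≤ ∫_γ g ds`, where `x` and `y` are the end points of `γ`. The left-hand side
is `∞` as soon as `f(x)` or `f(y)` is infinite (in `EReal`, `a - b` is infinite if `a` or `b` is,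
also for `a = b`). -/
def UpperGradientIneq {X : Type*} [MetricSpace X] (g : X → ℝ≥0∞) (f : X → EReal)
    (γ : Curve X) : Prop :=
  (f (γ.toFun 0) - f (γ.toFun γ.length)).abs ≤ γ.integral g

/-- The Borel function `g` is an upper gradient of `f` on `E`. -/
def IsUpperGradient {X : Type*} [MetricSpace X] [MeasurableSpace X]
    (E : Set X) (g : X → ℝ≥0∞) (f : X → EReal) : Prop :=
  Measurable g ∧ ∀ γ : Curve X, γ.InSet E → UpperGradientIneq g f γ

/-- The `p`-modulus of a family of curves. -/
def pModulus {X : Type*} [MetricSpace X] [MeasurableSpace X]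
    (μ : Measure X) (p : ℝ) (Γ : Set (Curve X)) : ℝ≥0∞ :=
  ⨅ (ρ : X → ℝ≥0∞) (_ : Measurable ρ) (_ : ∀ γ ∈ Γ, 1 ≤ γ.integral ρ), ∫⁻ x, ρ x ^ p ∂μ

/-- The measurable function `g` is a `p`-weak upper gradient of `f` on `E`: the inequality holds
for all curves in `E` outside a family of zero `p`-modulus. -/
def IsWeakUpperGradient {X : Type*} [MetricSpace X] [MeasurableSpace X]
    (μ : Measure X) (p : ℝ) (E : Set X) (g : X → ℝ≥0∞) (f : X → EReal) : Prop :=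
  AEMeasurable g (μ.restrict E) ∧
    pModulus (μ.restrict E) p {γ | γ.InSet E ∧ ¬ UpperGradientIneq g f γ} = 0

/-- `f ∈ D^p(E)`: `f` is measurable and has an upper gradient in `L^p(E)`. -/
def MemDirichlet {X : Type*} [MetricSpace X] [MeasurableSpace X]
    (μ : Measure X) (p : ℝ) (E : Set X) (f : X → EReal) : Prop :=
  AEMeasurable f (μ.restrict E) ∧
    ∃ g : X → ℝ≥0∞, IsUpperGradient E g f ∧ ∫⁻ x in E, g x ^ p ∂μ < ∞

/-- `f ∈ D^p_loc(E)`: every point of `E` lies in a ball `B` of the space `E` with `f ∈ D^p(B)`. -/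
def MemDirichletLoc {X : Type*} [MetricSpace X] [MeasurableSpace X]
    (μ : Measure X) (p : ℝ) (E : Set X) (f : X → EReal) : Prop :=
  ∀ x ∈ E, ∃ c ∈ E, ∃ r : ℝ, x ∈ ball c r ∧ MemDirichlet μ p (ball c r ∩ E) f

/-- The nonnegative function `g` has locally integrable `p`-th power on `E`. -/
def LocallyPIntegrable {X : Type*} [MetricSpace X] [MeasurableSpace X]
    (μ : Measure X) (p : ℝ) (E : Set X) (g : X → ℝ≥0∞) : Prop :=
  ∀ x ∈ E, ∃ c ∈ E, ∃ r : ℝ, x ∈ ball c r ∧ ∫⁻ y in ball c r ∩ E, g y ^ p ∂μ < ∞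

/-- `g` is a minimal `p`-weak upper gradient of `f` on `E`: it is a `p`-weak upper gradient in
`L^p_loc(E)` and lies a.e. below every other one. If `f ∈ D^p(E)`, then such a `g` is in `L^p(E)`,
because `f` has an upper gradient in `L^p(E)`. -/
def IsMinimalWeakUpperGradient {X : Type*} [MetricSpace X] [MeasurableSpace X]
    (μ : Measure X) (p : ℝ) (E : Set X) (g : X → ℝ≥0∞) (f : X → EReal) : Prop :=
  IsWeakUpperGradient μ p E g f ∧ LocallyPIntegrable μ p E g ∧
    ∀ g' : X → ℝ≥0∞, IsWeakUpperGradient μ p E g' f → LocallyPIntegrable μ p E g' →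
      ∀ᵐ x ∂μ.restrict E, g x ≤ g' x

open Classical in
/-- The minimal `p`-weak upper gradient `g_f` of `f` on `E` (unique up to a.e. equality on `E`);
it is set to be `∞` if `f` has none. -/
def minimalGradient {X : Type*} [MetricSpace X] [MeasurableSpace X]
    (μ : Measure X) (p : ℝ) (E : Set X) (f : X → EReal) : X → ℝ≥0∞ :=
  if h : ∃ g, IsMinimalWeakUpperGradient μ p E g f then h.choose else fun _ => ∞

/-- The energy `∫_E g_f^p dμ`. -/
def energy {X : Type*} [MetricSpace X] [MeasurableSpace X]
    (μ : Measure X) (p : ℝ) (E : Set X) (f : X → EReal) : ℝ≥0∞ :=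
  ∫⁻ x in E, minimalGradient μ p E f x ^ p ∂μ

/-- The Newtonian seminorm `(∫_E |f|^p dμ + ∫_E g_f^p dμ)^(1/p)`. -/
def newtonianNorm {X : Type*} [MetricSpace X] [MeasurableSpace X]
    (μ : Measure X) (p : ℝ) (E : Set X) (f : X → EReal) : ℝ≥0∞ :=
  (∫⁻ x in E, (f x).abs ^ p ∂μ + energy μ p E f) ^ (1 / p)

/-- `f ∈ N^{1,p}(E)`. -/
def MemNewtonian {X : Type*} [MetricSpace X] [MeasurableSpace X]
    (μ : Measure X) (p : ℝ) (E : Set X) (f : X → EReal) : Prop :=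
  MemDirichletLoc μ p E f ∧ newtonianNorm μ p E f < ∞

/-- The Sobolev capacity `C_p(E)`. -/
def capacity {X : Type*} [MetricSpace X] [MeasurableSpace X]
    (μ : Measure X) (p : ℝ) (E : Set X) : ℝ≥0∞ :=
  ⨅ (u : X → EReal) (_ : MemNewtonian μ p univ u) (_ : ∀ x ∈ E, 1 ≤ u x),
    newtonianNorm μ p univ u ^ p

/-- `f ∈ D^p_0(E)`: `f` is the restriction to `E` of a function in `D^p(X)` that vanishes
outside `E`. -/
def MemDirichletZero {X : Type*} [MetricSpace X] [MeasurableSpace X]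
    (μ : Measure X) (p : ℝ) (E : Set X) (f : X → EReal) : Prop :=
  ∃ h : X → EReal, MemDirichlet μ p univ h ∧ (∀ x ∉ E, h x = 0) ∧ ∀ x ∈ E, h x = f x

/-- `f ∈ N^{1,p}_0(E)`: `f` is the restriction to `E` of a function in `N^{1,p}(X)` that vanishes
outside `E`. -/
def MemNewtonianZero {X : Type*} [MetricSpace X] [MeasurableSpace X]
    (μ : Measure X) (p : ℝ) (E : Set X) (f : X → EReal) : Prop :=
  ∃ h : X → EReal, MemNewtonian μ p univ h ∧ (∀ x ∉ E, h x = 0) ∧ ∀ x ∈ E, h x = f x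

/-- The class `K_{ψ,f}(V)`. The value of `v - f` where it reads `∞ - ∞` is immaterial: every
curve through such a point has infinite integral for any upper gradient of `f`. -/
def obstacleClass {X : Type*} [MetricSpace X] [MeasurableSpace X]
    (μ : Measure X) (p : ℝ) (V : Set X) (ψ f : X → EReal) : Set (X → EReal) :=
  {v | MemDirichlet μ p V v ∧ MemDirichletZero μ p V (fun x => v x - f x) ∧
    capacity μ p {x ∈ V | ¬ ψ x ≤ v x} = 0}

/-- The class `K^B_{ψ,f}(V)`. -/
def boundedObstacleClass {X : Type*} [MetricSpace X] [MeasurableSpace X]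
    (μ : Measure X) (p : ℝ) (V : Set X) (ψ f : X → EReal) : Set (X → EReal) :=
  {v | MemNewtonian μ p V v ∧ MemNewtonianZero μ p V (fun x => v x - f x) ∧
    capacity μ p {x ∈ V | ¬ ψ x ≤ v x} = 0}

/-- `u` is a solution of the `K_{ψ,f}(V)`-obstacle problem. The first four fields are the
conditions under which the problem is posed. -/
structure IsObstacleSolution {X : Type*} [MetricSpace X] [MeasurableSpace X]
    (μ : Measure X) (p : ℝ) (V : Set X) (ψ f u : X → EReal) : Prop where
  nonempty : V.Nonempty
  isOpen : IsOpen V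
  capacity_compl_pos : 0 < capacity μ p Vᶜ
  boundary_mem : MemDirichlet μ p V f
  mem : u ∈ obstacleClass μ p V ψ f
  energy_le : ∀ v ∈ obstacleClass μ p V ψ f, energy μ p V u ≤ energy μ p V v

/-- `u` is a solution of the `K^B_{ψ,f}(V)`-obstacle problem. The first five fields are the
conditions under which the problem is posed. -/
structure IsBoundedObstacleSolution {X : Type*} [MetricSpace X] [MeasurableSpace X]
    (μ : Measure X) (p : ℝ) (V : Set X) (ψ f u : X → EReal) : Prop where
  nonempty : V.Nonempty
  isBounded : Bornology.IsBounded V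
  isOpen : IsOpen V
  capacity_compl_pos : 0 < capacity μ p Vᶜ
  boundary_mem : MemNewtonian μ p V f
  mem : u ∈ boundedObstacleClass μ p V ψ f
  energy_le : ∀ v ∈ boundedObstacleClass μ p V ψ f, energy μ p V u ≤ energy μ p V v

/-- `X` supports a `(q,p)`-Poincaré inequality: there are `C > 0` and `L ≥ 1` with
`(⨍_B |u - u_B|^q dμ)^(1/q) ≤ C diam(B) (⨍_{LB} g^p dμ)^(1/p)` for all balls `B`, all integrable `u`
and all upper gradients `g` of `u`. -/
def SupportsPoincare {X : Type*} [MetricSpace X] [MeasurableSpace X]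
    (μ : Measure X) (q p : ℝ) : Prop :=
  ∃ C : ℝ, 0 < C ∧ ∃ L : ℝ, 1 ≤ L ∧
    ∀ (x : X) (r : ℝ), 0 < r →
      ∀ u : X → ℝ, Integrable u μ →
        ∀ g : X → ℝ≥0∞, IsUpperGradient univ g (fun y => (u y : EReal)) →
          (⨍⁻ y in ball x r, ENNReal.ofReal |u y - ⨍ z in ball x r, u z ∂μ| ^ q ∂μ) ^ (1 / q) ≤
            ENNReal.ofReal (C * diam (ball x r)) *
              (⨍⁻ y in ball x (L * r), g y ^ p ∂μ) ^ (1 / p)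

end MetricObstacle

end

namespace MetricObstacle

/-! Both assertions rest on one description of weak upper gradients: `g` with locally integrable
`p`-th power is one for `f` exactly when, along almost every curve, `f` is real-valued and
absolutely continuous with derivative bounded a.e. by `g` (`AbsContAlong`).

Restriction is a pasting argument. Let `v` compete on `Ω'`, and let `h` be the extension of `v - u`
by zero. The function `w` equal to `v` in `Ω'` and to `u` in the rest of `Ω` is `u + h` along almost
every curve, hence absolutely continuous there. In `Ω'` its derivative is that of `v`. Outside, `h =
0`, and an absolutely continuous function has zero derivative at almost every zero, so the
derivative is that of `u`. Hence `g_v` in `Ω'` and `g_u` in `Ω \ Ω'` together form a weak upper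
gradient of `w` (`isWeakUpperGradient_piecewise`), and `w` competes on `Ω`. Minimality of `u` and
cancellation of the finite energy over `Ω \ Ω'` give the claim (`IsObstacleSolution.restrict`). It
suffices that `g_u` on `Ω` is a weak upper gradient on `Ω'`; equality of the two minimal gradients
is not needed.

For the bounded problem the competitors form a subclass with the same energy, so only `u ∈
N^{1,p}(Ω')` is at stake, that is, `L^p` integrability on the compact closure. The truncations of
`u` have a common upper gradient near a point, so the Poincaré inequality bounds their oscillation
uniformly. Their means are bounded because `|u| ≤ m` on a set of positive measure, and Fatou's lemma
concludes (`exists_ball_lintegral_abs_lt_top`). Such a set exists because otherwise every curve in a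
ball would carry infinite integral of an `L^p` function, against the Poincaré inequality
(`exists_measure_abs_le_ne_zero`). -/

/-- The majorant is the `ℓ^p` sum of the weighted functions: its `p`-th power integrates term by
term, for every `p > 0`. It merges countably many test functions for curve families into one. -/
theorem exists_weighted_majorant {X : Type*} [MeasurableSpace X] {ν : Measure X} {p : ℝ} (hp : 0 < p) (ρ : ℕ → X → ℝ≥0∞)
    (hρ : ∀ n, Measurable (ρ n)) (c : ℕ → ℝ≥0∞) (hc : ∑' n, c n * ∫⁻ x, ρ n x ^ p ∂ν < ∞) :
    ∃ σ : X → ℝ≥0∞, Measurable σ ∧ ∫⁻ x, σ x ^ p ∂ν < ∞ ∧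
      ∀ n x, c n ^ (1 / p) * ρ n x ≤ σ x := by
  have hm : ∀ n, Measurable fun x => c n * ρ n x ^ p := fun n =>
    ((hρ n).pow_const p).const_mul _
  refine ⟨fun x => (∑' n, c n * ρ n x ^ p) ^ (1 / p), (Measurable.tsum hm).pow_const _, ?_, ?_⟩
  · simp only [one_div, ENNReal.rpow_inv_rpow hp.ne']
    rw [lintegral_tsum fun n => (hm n).aemeasurable]
    simpa only [lintegral_const_mul _ ((hρ _).pow_const p)] using hc
  · intro n x
    have : c n ^ (1 / p) * ρ n x = (c n * ρ n x ^ p) ^ (1 / p) := by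
      rw [ENNReal.mul_rpow_of_nonneg _ _ (by positivity), one_div, ENNReal.rpow_rpow_inv hp.ne']
    rw [this]
    exact ENNReal.rpow_le_rpow (ENNReal.le_tsum n) (by positivity)

/-! ### Arc-length parametrized curves and their subcurves. -/

variable {X : Type*} [MetricSpace X]

theorem Curve.dist_le (γ : Curve X) {s t : ℝ} (hs : s ∈ Icc 0 γ.length)
    (ht : t ∈ Icc 0 γ.length) : dist (γ.toFun s) (γ.toFun t) ≤ |s - t| := by
  wlog hst : s ≤ t generalizing s t
  · rw [dist_comm, abs_sub_comm]
    exact this ht hs (le_of_not_ge hst)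
  have h := γ.unitSpeed hs ht
  have h' := eVariationOn.edist_le γ.toFun (s := Icc 0 γ.length ∩ Icc s t)
    ⟨hs, left_mem_Icc.2 hst⟩ ⟨ht, right_mem_Icc.2 hst⟩
  rw [h, edist_dist] at h'
  have h0 : (0 : ℝ) ≤ t - s := sub_nonneg.2 hst
  rw [NNReal.coe_one, one_mul, ENNReal.ofReal_le_ofReal_iff h0] at h'
  rwa [abs_sub_comm, abs_of_nonneg h0]

theorem Curve.continuousOn (γ : Curve X) : ContinuousOn γ.toFun (Icc 0 γ.length) := by
  have : LipschitzOnWith 1 γ.toFun (Icc 0 γ.length) :=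
    LipschitzOnWith.of_dist_le_mul fun s hs t ht => by
      simpa [Real.dist_eq] using γ.dist_le hs ht
  exact this.continuousOn

/-- The curve `σ` is the restriction of `γ` to an interval, up to a translation. -/
def Curve.IsSub (σ γ : Curve X) : Prop :=
  ∃ a, 0 ≤ a ∧ a + σ.length ≤ γ.length ∧ ∀ t, σ.toFun t = γ.toFun (a + t)

theorem Curve.exists_sub (γ : Curve X) {a b : ℝ} (ha : 0 ≤ a) (hab : a < b)
    (hb : b ≤ γ.length) :
    ∃ σ : Curve X, σ.length = b - a ∧ ∀ t, σ.toFun t = γ.toFun (a + t) := by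
  refine ⟨⟨b - a, sub_pos.2 hab, fun t => γ.toFun (a + t), ?_⟩, rfl, fun _ => rfl⟩
  intro x hx y hy
  have hmono : MonotoneOn (fun t : ℝ => a + t) (Icc 0 (b - a) ∩ Icc x y) :=
    fun s _ t _ hst => by simpa using hst
  have h1 := eVariationOn.comp_eq_of_monotoneOn γ.toFun (fun t : ℝ => a + t) hmono
  have himg : (fun t : ℝ => a + t) '' (Icc 0 (b - a) ∩ Icc x y)
      = Icc 0 γ.length ∩ Icc (a + x) (a + y) := by
    ext t
    simp only [mem_image, mem_inter_iff, mem_Icc] at hx hy ⊢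
    constructor
    · rintro ⟨s, ⟨⟨h1, h2⟩, h3, h4⟩, rfl⟩
      exact ⟨⟨by linarith, by linarith⟩, by linarith, by linarith⟩
    · rintro ⟨⟨h1, h2⟩, h3, h4⟩
      exact ⟨t - a, ⟨⟨by linarith, by linarith⟩, by linarith, by linarith⟩, by ring⟩
  rw [himg] at h1
  change eVariationOn (γ.toFun ∘ fun t => a + t) _ = _
  rw [h1, γ.unitSpeed (x := a + x) (y := a + y)]
  · congr 2; ring
  · exact ⟨by linarith [hx.1], by linarith [hx.2]⟩
  · exact ⟨by linarith [hy.1], by linarith [hy.2]⟩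

theorem Curve.integral_sub {σ γ : Curve X} {a : ℝ} (h : ∀ t, σ.toFun t = γ.toFun (a + t))
    (g : X → ℝ≥0∞) :
    σ.integral g = ∫⁻ t in Icc a (a + σ.length), g (γ.toFun t) := by
  have := (measurePreserving_add_left (volume : Measure ℝ) a).setLIntegral_comp_preimage_emb
    (measurableEmbedding_addLeft a) (fun t => g (γ.toFun t)) (Icc a (a + σ.length))
  rw [← this]
  simp [Curve.integral, h]

theorem Curve.IsSub.integral_le {σ γ : Curve X} (h : σ.IsSub γ) (g : X → ℝ≥0∞) :
    σ.integral g ≤ γ.integral g := by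
  obtain ⟨a, ha, hl, h⟩ := h
  rw [Curve.integral_sub h]
  exact lintegral_mono_set (Icc_subset_Icc ha hl)

theorem Curve.IsSub.inSet {σ γ : Curve X} (h : σ.IsSub γ) {E : Set X} (hE : γ.InSet E) :
    σ.InSet E := by
  obtain ⟨a, ha, hl, h⟩ := h
  intro t ht
  rw [h]
  exact hE _ ⟨by linarith [ht.1], by linarith [ht.2]⟩

theorem Curve.isSub_refl (γ : Curve X) : γ.IsSub γ := ⟨0, le_rfl, by simp, by simp⟩

theorem Curve.InSet.mono {γ : Curve X} {E F : Set X} (h : γ.InSet E) (hEF : E ⊆ F) : γ.InSet F :=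
  fun t ht => hEF (h t ht)

/-- A curve that meets an open set has a subcurve in it through the given point. -/
theorem Curve.exists_sub_of_mem_open (γ : Curve X) {U : Set X} (hU : IsOpen U) {t : ℝ}
    (ht : t ∈ Icc 0 γ.length) (htU : γ.toFun t ∈ U) :
    ∃ a b, 0 ≤ a ∧ a < b ∧ b ≤ γ.length ∧ t ∈ Icc a b ∧
      (t ∈ Ioo 0 γ.length → t ∈ Ioo a b) ∧ ∀ s ∈ Icc a b, γ.toFun s ∈ U := by
  have hmem := (γ.continuousOn t ht).preimage_mem_nhdsWithin (hU.mem_nhds htU)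
  obtain ⟨ε, hε, h⟩ := Metric.mem_nhdsWithin_iff.1 hmem
  have hl := γ.length_pos
  refine ⟨max 0 (t - ε / 2), min γ.length (t + ε / 2), le_max_left _ _, ?_, min_le_left _ _,
    ⟨?_, ?_⟩, fun h' => ⟨?_, ?_⟩, fun s hs => h ⟨?_, ?_⟩⟩
  · rw [max_lt_iff, lt_min_iff, lt_min_iff]
    exact ⟨⟨hl, by linarith [ht.1]⟩, by linarith [ht.2], by linarith⟩
  · exact max_le ht.1 (by linarith)
  · exact le_min ht.2 (by linarith)
  · exact max_lt h'.1 (by linarith)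
  · exact lt_min h'.2 (by linarith)
  · have h1 := (le_max_right _ _).trans hs.1
    have h2 := hs.2.trans (min_le_right _ _)
    rw [mem_ball, Real.dist_eq, abs_lt]
    constructor <;> linarith
  · exact ⟨(le_max_left _ _).trans hs.1, hs.2.trans (min_le_left _ _)⟩

theorem Curve.integral_mono (γ : Curve X) {g h : X → ℝ≥0∞} (H : ∀ x, g x ≤ h x) :
    γ.integral g ≤ γ.integral h := lintegral_mono fun _ => H _

theorem Curve.const_mul_integral_le (γ : Curve X) {g : X → ℝ≥0∞} (c : ℝ≥0∞) :
    c * γ.integral g ≤ γ.integral fun x => c * g x := lintegral_const_mul_le _ _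

/-! ### Exceptional families and properties of almost every curve. -/

variable [MeasurableSpace X]

/-- A family of curves is exceptional if some Borel function in `L^p` has infinite integral along
each of its members. -/
def Exceptional (ν : Measure X) (p : ℝ) (Γ : Set (Curve X)) : Prop :=
  ∃ ρ : X → ℝ≥0∞, Measurable ρ ∧ ∫⁻ x, ρ x ^ p ∂ν < ∞ ∧ ∀ γ ∈ Γ, γ.integral ρ = ∞

/-- Small multiples of a function with infinite integrals stay admissible, so the modulus vanishes.
Conversely, admissible functions of energy below `4⁻ⁿ`, weighted by `2ⁿ`, have a majorant in `L^p`
whose integral along each curve exceeds every `2^(n/p)`. -/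
theorem exceptional_iff_pModulus_eq_zero {ν : Measure X} {p : ℝ} (hp : 0 < p)
    {Γ : Set (Curve X)} : Exceptional ν p Γ ↔ pModulus ν p Γ = 0 := by
  constructor
  · rintro ⟨ρ, hρ, hfin, hΓ⟩
    refine le_antisymm (ENNReal.le_of_forall_pos_le_add fun ε hε _ => ?_) bot_le
    rw [zero_add]
    obtain ⟨δ, hδ0, hδ⟩ : ∃ δ : ℝ≥0∞, δ ≠ 0 ∧ δ * ∫⁻ x, ρ x ^ p ∂ν ≤ ε := by
      refine ⟨ε / (1 + ∫⁻ x, ρ x ^ p ∂ν), ?_, ?_⟩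
      · exact ENNReal.div_ne_zero.2 ⟨by positivity, by simp [hfin.ne]⟩
      · calc _ ≤ ε / (1 + ∫⁻ x, ρ x ^ p ∂ν) * (1 + ∫⁻ x, ρ x ^ p ∂ν) := by gcongr; simp
          _ = ε := ENNReal.div_mul_cancel (by simp) (by simp [hfin.ne])
    have hδ1 : δ ^ (1 / p) ≠ 0 := by
      intro h
      rw [ENNReal.rpow_eq_zero_iff] at h
      rcases h with h | h
      · exact hδ0 h.1
      · exact absurd h.2 (not_lt.2 (by positivity))
    refine iInf_le_of_le (fun x => δ ^ (1 / p) * ρ x) (iInf_le_of_le (hρ.const_mul _)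
      (iInf_le_of_le (fun γ hγ => ?_) ?_))
    · refine le_trans ?_ (γ.const_mul_integral_le _)
      rw [hΓ γ hγ, ENNReal.mul_top hδ1]
      exact le_top
    · simp only [ENNReal.mul_rpow_of_nonneg _ _ hp.le, one_div, ENNReal.rpow_inv_rpow hp.ne']
      rwa [lintegral_const_mul _ (hρ.pow_const p)]
  · intro h
    have key : ∀ n : ℕ, ∃ ρ : X → ℝ≥0∞, Measurable ρ ∧ (∀ γ ∈ Γ, 1 ≤ γ.integral ρ) ∧
        ∫⁻ x, ρ x ^ p ∂ν < (4 : ℝ≥0∞)⁻¹ ^ n := by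
      intro n
      have hlt : pModulus ν p Γ < (4 : ℝ≥0∞)⁻¹ ^ n := by
        rw [h]; exact ENNReal.pow_pos (by simp) n
      simp only [pModulus, iInf_lt_iff] at hlt
      obtain ⟨ρ, h1, h2, h3⟩ := hlt
      exact ⟨ρ, h1, h2, h3⟩
    choose ρ hρ h1 h2 using key
    obtain ⟨σ, hσ, hfin, hle⟩ := exists_weighted_majorant (ν := ν) hp ρ hρ (fun n => 2 ^ n) (by
      calc ∑' n, (2 : ℝ≥0∞) ^ n * ∫⁻ x, ρ n x ^ p ∂ν
          ≤ ∑' n : ℕ, (2 : ℝ≥0∞)⁻¹ ^ n := by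
            refine ENNReal.tsum_le_tsum fun n => ?_
            calc (2 : ℝ≥0∞) ^ n * ∫⁻ x, ρ n x ^ p ∂ν ≤ 2 ^ n * 4⁻¹ ^ n := by
                  gcongr; exact (h2 n).le
              _ = 2⁻¹ ^ n := by
                  rw [← mul_pow]
                  congr 1
                  rw [show (4 : ℝ≥0∞) = 2 * 2 by norm_num,
                    ENNReal.mul_inv (by simp) (by simp), ← mul_assoc,
                    ENNReal.mul_inv_cancel (by simp) (by simp), one_mul]
        _ < ∞ := by rw [ENNReal.tsum_geometric_two]; simp)
    refine ⟨σ, hσ, hfin, fun γ hγ => ?_⟩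
    have hall : ∀ n : ℕ, ((2 : ℝ≥0∞) ^ n) ^ (1 / p) ≤ γ.integral σ := fun n =>
      calc ((2 : ℝ≥0∞) ^ n) ^ (1 / p) ≤ ((2 : ℝ≥0∞) ^ n) ^ (1 / p) * γ.integral (ρ n) := by
            simpa using mul_le_mul_right (h1 n γ hγ) (((2 : ℝ≥0∞) ^ n) ^ (1 / p))
        _ ≤ γ.integral fun x => ((2 : ℝ≥0∞) ^ n) ^ (1 / p) * ρ n x := γ.const_mul_integral_le _
        _ ≤ γ.integral σ := γ.integral_mono (hle n)
    by_contra hne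
    have h3 : ∀ n : ℕ, (2 : ℝ≥0∞) ^ n ≤ γ.integral σ ^ p := fun n => by
      have := ENNReal.rpow_le_rpow (hall n) hp.le
      rwa [one_div, ENNReal.rpow_inv_rpow hp.ne'] at this
    have h4 : γ.integral σ ^ p ≠ ∞ := ENNReal.rpow_ne_top_of_nonneg hp.le hne
    obtain ⟨n, hn⟩ := ENNReal.exists_nat_gt h4
    refine absurd (h3 n) (not_le.2 (hn.trans_le ?_))
    exact_mod_cast Nat.lt_two_pow_self.le

theorem Exceptional.mono {ν : Measure X} {p : ℝ} {Γ Γ' : Set (Curve X)}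
    (h : Exceptional ν p Γ) (hΓ : Γ' ⊆ Γ) : Exceptional ν p Γ' := by
  obtain ⟨ρ, h1, h2, h3⟩ := h
  exact ⟨ρ, h1, h2, fun γ hγ => h3 γ (hΓ hγ)⟩

theorem Exceptional.iUnion {ν : Measure X} {p : ℝ} (hp : 0 < p) {Γ : ℕ → Set (Curve X)}
    (h : ∀ n, Exceptional ν p (Γ n)) : Exceptional ν p (⋃ n, Γ n) := by
  choose ρ hρ hfin hΓ using h
  set I : ℕ → ℝ≥0∞ := fun n => ∫⁻ x, ρ n x ^ p ∂ν
  -- The weights are positive, so infinite integrals stay infinite, and they make the energies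
  -- summable; the `1 +` avoids division by zero.
  obtain ⟨σ, hσ, hσfin, hle⟩ := exists_weighted_majorant (ν := ν) hp ρ hρ
    (fun n => (2 : ℝ≥0∞)⁻¹ ^ n / (1 + I n)) (by
      calc ∑' n, (2 : ℝ≥0∞)⁻¹ ^ n / (1 + I n) * I n ≤ ∑' n : ℕ, (2 : ℝ≥0∞)⁻¹ ^ n := by
            refine ENNReal.tsum_le_tsum fun n => ?_
            calc _ ≤ (2 : ℝ≥0∞)⁻¹ ^ n / (1 + I n) * (1 + I n) := by gcongr; simp
              _ = _ := ENNReal.div_mul_cancel (by simp) (by simp [I, (hfin n).ne])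
        _ < ∞ := by rw [ENNReal.tsum_geometric_two]; simp)
  refine ⟨σ, hσ, hσfin, fun γ hγ => ?_⟩
  obtain ⟨n, hn⟩ := mem_iUnion.1 hγ
  have hc : (2 : ℝ≥0∞)⁻¹ ^ n / (1 + I n) ≠ 0 :=
    ENNReal.div_ne_zero.2 ⟨by simp, by simp [I, (hfin n).ne]⟩
  have hc' : ((2 : ℝ≥0∞)⁻¹ ^ n / (1 + I n)) ^ (1 / p) ≠ 0 := by
    intro h
    rw [ENNReal.rpow_eq_zero_iff] at h
    rcases h with h | h
    · exact hc h.1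
    · exact absurd h.2 (not_lt.2 (by positivity))
  refine top_le_iff.1 (le_trans ?_ (γ.integral_mono (hle n)))
  refine le_trans ?_ (γ.const_mul_integral_le _)
  rw [hΓ n γ hn, ENNReal.mul_top hc']

/-- The property `P` holds for all curves in `E` outside an exceptional family. -/
def AEAlong (μ : Measure X) (p : ℝ) (E : Set X) (P : Curve X → Prop) : Prop :=
  Exceptional (μ.restrict E) p {γ | γ.InSet E ∧ ¬ P γ}

variable {μ : Measure X} {p : ℝ} {E : Set X} {P Q : Curve X → Prop}

theorem AEAlong.mono (h : AEAlong μ p E P) (H : ∀ γ : Curve X, γ.InSet E → P γ → Q γ) :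
    AEAlong μ p E Q :=
  Exceptional.mono h fun γ hγ => ⟨hγ.1, fun hP => hγ.2 (H γ hγ.1 hP)⟩

theorem AEAlong.of_forall (H : ∀ γ : Curve X, γ.InSet E → P γ) (hp : 0 < p) : AEAlong μ p E P :=
  ⟨0, measurable_const, by simp [hp], fun γ hγ => absurd (H γ hγ.1) hγ.2⟩

theorem AEAlong.all (hp : 0 < p) {P : ℕ → Curve X → Prop} (h : ∀ n, AEAlong μ p E (P n)) :
    AEAlong μ p E fun γ => ∀ n, P n γ := by
  refine (Exceptional.iUnion hp h).mono fun γ hγ => ?_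
  have := hγ.2
  push Not at this
  obtain ⟨n, hn⟩ := this
  exact mem_iUnion.2 ⟨n, hγ.1, hn⟩

theorem AEAlong.and (hp : 0 < p) (h : AEAlong μ p E P) (h' : AEAlong μ p E Q) :
    AEAlong μ p E fun γ => P γ ∧ Q γ := by
  refine (AEAlong.all hp (P := fun n γ => if n = 0 then P γ else Q γ) fun n => ?_).mono
    fun γ _ hγ => ⟨by simpa using hγ 0, by simpa using hγ 1⟩
  by_cases hn : n = 0 <;> simpa [hn]

/-- If `P` holds for almost every curve in the smaller set `F`, then for almost every curve in
`E` it holds for all subcurves in `F`. -/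
theorem AEAlong.sub_of_subset {F : Set X} (hp : 0 < p) (hF : MeasurableSet F)
    (h : AEAlong μ p F P) :
    AEAlong μ p E fun γ => ∀ σ : Curve X, σ.IsSub γ → σ.InSet F → P σ := by
  obtain ⟨ρ, h1, h2, h3⟩ := h
  -- Extended by zero, the test function for `F` already has infinite integral over the bad
  -- subcurve.
  refine ⟨F.indicator ρ, h1.indicator hF, ?_, fun γ hγ => ?_⟩
  · have : ∀ x, F.indicator ρ x ^ p = F.indicator (fun x => ρ x ^ p) x := fun x => by
      by_cases hx : x ∈ F <;> simp [hx, hp]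
    simp only [this]
    rw [lintegral_indicator hF]
    exact lt_of_le_of_lt (lintegral_mono' (Measure.restrict_mono' (ae_of_all _ fun _ h => h)
      Measure.restrict_le_self) le_rfl) h2
  · have := hγ.2
    push Not at this
    obtain ⟨σ, hσ, hσF, hP⟩ := this
    refine top_le_iff.1 (le_trans ?_ (hσ.integral_le _))
    rw [← h3 σ ⟨hσF, hP⟩]
    refine (setLIntegral_congr_fun measurableSet_Icc fun t ht => ?_).le
    simp [indicator_of_mem (hσF t ht)]

theorem AEAlong.sub (h : AEAlong μ p E P) :
    AEAlong μ p E fun γ => ∀ σ : Curve X, σ.IsSub γ → P σ := by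
  obtain ⟨ρ, h1, h2, h3⟩ := h
  refine ⟨ρ, h1, h2, fun γ hγ => ?_⟩
  have := hγ.2
  push Not at this
  obtain ⟨σ, hσ, hP⟩ := this
  refine top_le_iff.1 (le_trans ?_ (hσ.integral_le _))
  rw [h3 σ ⟨hσ.inSet hγ.1, hP⟩]

theorem AEAlong.of_subset {F : Set X} (hEF : E ⊆ F) (h : AEAlong μ p F P) : AEAlong μ p E P := by
  obtain ⟨ρ, h1, h2, h3⟩ := h
  exact ⟨ρ, h1, (lintegral_mono_set hEF).trans_lt h2, fun γ hγ => h3 γ ⟨hγ.1.mono hEF, hγ.2⟩⟩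

theorem AEAlong.integral_lt_top {g : X → ℝ≥0∞} (hg : Measurable g)
    (h : ∫⁻ x in E, g x ^ p ∂μ < ∞) : AEAlong μ p E fun γ => γ.integral g < ∞ :=
  ⟨g, hg, h, fun γ hγ => by simpa using hγ.2⟩

section Borel

variable [BorelSpace X]

theorem Curve.aemeasurable_comp (γ : Curve X) {g : X → ℝ≥0∞} (hg : Measurable g) :
    AEMeasurable (fun t => g (γ.toFun t)) (volume.restrict (Icc 0 γ.length)) :=
  hg.comp_aemeasurable (γ.continuousOn.aemeasurable measurableSet_Icc)

/-- A null set of `E` is met by almost every curve in `E` in zero length. -/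
theorem AEAlong.ae_of_ae (hp : 0 < p) {q : X → Prop} (h : ∀ᵐ x ∂μ.restrict E, q x) :
    AEAlong μ p E fun γ => ∀ᵐ t ∂volume.restrict (Icc 0 γ.length), q (γ.toFun t) := by
  set N := toMeasurable (μ.restrict E) {x | ¬ q x}
  have hN : MeasurableSet N := measurableSet_toMeasurable _ _
  have hN0 : μ.restrict E N = 0 := by rw [measure_toMeasurable]; exact h
  -- The value `∞` on a null set costs no energy, but forces an infinite integral along each curve
  -- that spends positive length there.
  refine ⟨N.indicator fun _ => ∞, measurable_const.indicator hN, ?_, fun γ hγ => ?_⟩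
  · have : ∀ x, N.indicator (fun _ => (∞ : ℝ≥0∞)) x ^ p = N.indicator (fun _ => ∞) x := fun x => by
      by_cases hx : x ∈ N <;> simp [hx, hp]
    simp only [this]
    rw [lintegral_indicator_const hN, hN0]
    simp
  · by_contra hne
    refine hγ.2 ?_
    have := ae_lt_top' (γ.aemeasurable_comp (measurable_const.indicator hN)) hne
    filter_upwards [this] with t ht
    by_contra hq
    have : γ.toFun t ∈ N := subset_toMeasurable _ _ hq
    simp [this] at ht

/-- By the Lindelöf property countably many balls with finite energy cover `E`. Almost every curve
has finite integral over each of them, and its compact image needs only finitely many. -/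
theorem AEAlong.integral_lt_top_of_locally [SecondCountableTopology X] (hp : 0 < p)
    {g : X → ℝ≥0∞} (hg : Measurable g) (h : LocallyPIntegrable μ p E g) :
    AEAlong μ p E fun γ => γ.integral g < ∞ := by
  rcases E.eq_empty_or_nonempty with rfl | hne
  · exact AEAlong.of_forall (fun γ hγ => absurd (hγ 0 ⟨le_rfl, γ.length_pos.le⟩) (by simp)) hp
  choose! c hc r hr hfin using h
  obtain ⟨T, hTE, hT, hcov⟩ := TopologicalSpace.countable_cover_nhdsWithin
    (f := fun x => ball (c x) (r x)) (s := E)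
    (fun x hx => mem_nhdsWithin_of_mem_nhds (isOpen_ball.mem_nhds (hr x hx)))
  have hTne : T.Nonempty := by
    obtain ⟨x, hx⟩ := hne
    obtain ⟨y, hy, _⟩ := mem_iUnion₂.1 (hcov hx)
    exact ⟨y, hy⟩
  obtain ⟨e, rfl⟩ := hT.exists_eq_range hTne
  have hm : ∀ n, Measurable ((ball (c (e n)) (r (e n))).indicator g) := fun n =>
    hg.indicator measurableSet_ball
  have := AEAlong.all hp (μ := μ) (E := E) fun n => AEAlong.integral_lt_top (hm n) (by
    have h0 : ∀ x, (ball (c (e n)) (r (e n))).indicator g x ^ p =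
        (ball (c (e n)) (r (e n))).indicator (fun x => g x ^ p) x := fun x => by
      by_cases hx : x ∈ ball (c (e n)) (r (e n)) <;> simp [hx, hp, -mem_ball]
    simp only [h0]
    rw [lintegral_indicator measurableSet_ball, Measure.restrict_restrict measurableSet_ball]
    exact hfin _ (hTE ⟨n, rfl⟩))
  refine this.mono fun γ hγ hfin => ?_
  have hK : IsCompact (γ.toFun '' Icc 0 γ.length) := isCompact_Icc.image_of_continuousOn γ.continuousOn
  obtain ⟨s, hs⟩ := hK.elim_finite_subcover (fun n => ball (c (e n)) (r (e n)))
    (fun _ => isOpen_ball) (by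
      rintro _ ⟨t, ht, rfl⟩
      obtain ⟨y, ⟨n, rfl⟩, hy⟩ := mem_iUnion₂.1 (hcov (hγ t ht))
      exact mem_iUnion.2 ⟨n, hy⟩)
  calc γ.integral g ≤ ∫⁻ t in Icc 0 γ.length,
        ∑ n ∈ s, (ball (c (e n)) (r (e n))).indicator g (γ.toFun t) := by
        refine setLIntegral_mono' measurableSet_Icc fun t ht => ?_
        obtain ⟨n, hn, hmem⟩ := mem_iUnion₂.1 (hs ⟨t, ht, rfl⟩)
        refine le_trans ?_ (Finset.single_le_sum (f := fun n =>
          (ball (c (e n)) (r (e n))).indicator g (γ.toFun t)) (fun _ _ => bot_le) hn)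
        simp only [indicator_of_mem hmem, le_refl]
    _ = ∑ n ∈ s, γ.integral ((ball (c (e n)) (r (e n))).indicator g) :=
        lintegral_finsetSum' _ fun n _ => γ.aemeasurable_comp (hm n)
    _ < ∞ := ENNReal.sum_lt_top.2 fun n _ => hfin n

end Borel

end MetricObstacle

namespace MetricObstacle

/-! ### Absolutely continuous functions on an interval. -/

section Real

theorem absolutelyContinuousOnInterval_of_dist_le {F G : ℝ → ℝ} {a b : ℝ}
    (hG : AbsolutelyContinuousOnInterval G a b)
    (h : ∀ s ∈ uIcc a b, ∀ t ∈ uIcc a b, dist (F s) (F t) ≤ dist (G s) (G t)) :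
    AbsolutelyContinuousOnInterval F a b := by
  refine squeeze_zero' (Filter.Eventually.of_forall fun _ =>
    Finset.sum_nonneg fun _ _ => dist_nonneg) ?_ hG
  refine Filter.eventually_inf_principal.2 (Filter.Eventually.of_forall fun I hI => ?_)
  exact Finset.sum_le_sum fun i hi => h _ (hI.1 i hi).1 _ (hI.1 i hi).2

theorem ae_restrict_Icc_mem_Ioo (a b : ℝ) : ∀ᵐ t ∂volume.restrict (Icc a b), t ∈ Ioo a b := by
  rw [← restrict_Ioo_eq_restrict_Icc]
  exact ae_restrict_mem measurableSet_Ioo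

theorem AbsolutelyContinuousOnInterval.ae_hasDerivAt {F : ℝ → ℝ} {l : ℝ} (hl : 0 ≤ l)
    (hF : AbsolutelyContinuousOnInterval F 0 l) :
    ∀ᵐ t ∂volume.restrict (Icc 0 l), HasDerivAt F (deriv F t) t := by
  rw [ae_restrict_iff' measurableSet_Icc]
  filter_upwards [hF.ae_differentiableAt] with t ht h
  exact (ht (by rwa [uIcc_of_le hl])).hasDerivAt

/-- The increments of `F` are dominated by those of the indefinite integral `Φ` of `G`. Absolute
continuity passes from `Φ` to `F`, and comparing difference quotients bounds the derivative by
Lebesgue differentiation. -/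
theorem absolutelyContinuous_of_le_lintegral {F : ℝ → ℝ} {G : ℝ → ℝ≥0∞} {l : ℝ} (hl : 0 ≤ l)
    (hG : AEMeasurable G (volume.restrict (Icc 0 l))) (hfin : ∫⁻ t in Icc 0 l, G t < ∞)
    (h : ∀ s t, 0 ≤ s → s < t → t ≤ l → ENNReal.ofReal |F s - F t| ≤ ∫⁻ r in Icc s t, G r) :
    AbsolutelyContinuousOnInterval F 0 l ∧
      ∀ᵐ t ∂volume.restrict (Icc 0 l), ‖deriv F t‖ₑ ≤ G t := by
  set φ : ℝ → ℝ := fun t => (G t).toReal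
  have hint : IntegrableOn φ (Icc 0 l) := integrable_toReal_of_lintegral_ne_top hG hfin.ne
  have hfinae : ∀ᵐ t ∂volume.restrict (Icc 0 l), G t < ∞ := ae_lt_top' hG hfin.ne
  have hII : IntervalIntegrable φ volume 0 l := by
    rw [intervalIntegrable_iff_integrableOn_Icc_of_le hl]; exact hint
  set Φ : ℝ → ℝ := fun t => ∫ r in (0 : ℝ)..t, φ r
  have hΦ : AbsolutelyContinuousOnInterval Φ 0 l :=
    hII.absolutelyContinuousOnInterval_intervalIntegral (c := 0) (by simp)
  have hlt : ∀ s t, 0 ≤ s → s < t → t ≤ l → |F s - F t| ≤ |Φ s - Φ t| := by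
    intro s t hs hst ht
    have hsub : Icc s t ⊆ Icc 0 l := Icc_subset_Icc hs ht
    have h1 : Φ t - Φ s = ∫ r in s..t, φ r := by
      refine intervalIntegral.integral_interval_sub_left ?_ ?_ <;>
      · rw [intervalIntegrable_iff_integrableOn_Icc_of_le (by linarith)]
        exact hint.mono_set (Icc_subset_Icc le_rfl (by linarith))
    have h2 : ∫⁻ r in Icc s t, G r = ENNReal.ofReal (Φ t - Φ s) := by
      rw [h1, intervalIntegral.integral_of_le hst.le, ← integral_Icc_eq_integral_Ioc,
        ofReal_integral_eq_lintegral_ofReal (hint.mono_set hsub)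
          (Filter.Eventually.of_forall fun _ => ENNReal.toReal_nonneg)]
      refine lintegral_congr_ae ?_
      filter_upwards [ae_restrict_of_ae_restrict_of_subset hsub hfinae] with r hr
      exact (ENNReal.ofReal_toReal hr.ne).symm
    have h3 := h s t hs hst ht
    have h4 : 0 ≤ Φ t - Φ s := by
      rw [h1]
      exact intervalIntegral.integral_nonneg hst.le fun _ _ => ENNReal.toReal_nonneg
    rw [h2, ENNReal.ofReal_le_ofReal_iff h4] at h3
    exact h3.trans ((le_abs_self _).trans (abs_sub_comm _ _).le)
  have hdist : ∀ s ∈ Icc 0 l, ∀ t ∈ Icc 0 l, dist (F s) (F t) ≤ dist (Φ s) (Φ t) := by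
    intro s hs t ht
    rw [Real.dist_eq, Real.dist_eq]
    rcases lt_trichotomy s t with hst | rfl | hst
    · exact hlt s t hs.1 hst ht.2
    · simp
    · rw [abs_sub_comm, abs_sub_comm (Φ s)]
      exact hlt t s ht.1 hst hs.2
  have hF : AbsolutelyContinuousOnInterval F 0 l :=
    absolutelyContinuousOnInterval_of_dist_le hΦ (by rwa [uIcc_of_le hl])
  refine ⟨hF, ?_⟩
  have hd := hII.ae_hasDerivAt_integral
  filter_upwards [hfinae, AbsolutelyContinuousOnInterval.ae_hasDerivAt hl hF,
    ae_restrict_of_ae hd, ae_restrict_Icc_mem_Ioo 0 l] with t ht hFt hΦt htI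
  have hΦt' : HasDerivAt Φ (φ t) t :=
    hΦt (by rw [uIcc_of_le hl]; exact Ioo_subset_Icc_self htI) 0 (by simp)
  have hle : ‖deriv F t‖ ≤ ‖φ t‖ := by
    refine le_of_tendsto_of_tendsto (hasDerivAt_iff_tendsto_slope.1 hFt).norm
      (hasDerivAt_iff_tendsto_slope.1 hΦt').norm ?_
    filter_upwards [mem_nhdsWithin_of_mem_nhds (Icc_mem_nhds htI.1 htI.2)] with s hs
    simp only [slope_def_module, norm_smul]
    gcongr
    simpa [Real.dist_eq] using hdist s hs t (Ioo_subset_Icc_self htI)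
  calc ‖deriv F t‖ₑ ≤ ‖φ t‖ₑ := by simpa only [enorm_le_iff_norm_le] using hle
    _ = G t := by
      rw [Real.enorm_eq_ofReal ENNReal.toReal_nonneg, ENNReal.ofReal_toReal ht.ne]

theorem AbsolutelyContinuousOnInterval.ofReal_abs_sub_le {F : ℝ → ℝ} {G : ℝ → ℝ≥0∞} {l : ℝ}
    (hl : 0 ≤ l) (hF : AbsolutelyContinuousOnInterval F 0 l)
    (hG : ∀ᵐ t ∂volume.restrict (Icc 0 l), ‖deriv F t‖ₑ ≤ G t) :
    ENNReal.ofReal |F 0 - F l| ≤ ∫⁻ t in Icc 0 l, G t := by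
  rw [abs_sub_comm, ← hF.integral_deriv_eq_sub, ← Real.enorm_eq_ofReal_abs,
    intervalIntegral.integral_of_le hl, ← integral_Icc_eq_integral_Ioc]
  exact (enorm_integral_le_lintegral_enorm _).trans (lintegral_mono_ae hG)

/-- An absolutely continuous function has zero derivative at almost every zero. -/
theorem ae_deriv_eq_zero_of_eq_zero {F : ℝ → ℝ} {l : ℝ} (hl : 0 ≤ l)
    (hF : AbsolutelyContinuousOnInterval F 0 l) :
    ∀ᵐ t ∂volume.restrict (Icc 0 l), F t = 0 → deriv F t = 0 := by
  set S : Set ℝ := {t | F t = 0}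
  -- Zeros isolated from the right are countable, hence null. At any other zero the derivative can
  -- be computed along zeros alone.
  have hc' : ∀ᵐ t ∂volume.restrict (Icc 0 l), t ∉ {t ∈ S | nhdsWithin t (S ∩ Ioi t) = ⊥} :=
    ae_restrict_of_ae (measure_eq_zero_iff_ae_notMem.1
      (countable_setOfPred_isolated_right_within.measure_zero _))
  filter_upwards [hc', AbsolutelyContinuousOnInterval.ae_hasDerivAt hl hF] with t ht hd hFt
  have hacc : AccPt t (Filter.principal S) := by
    rw [accPt_principal_iff_nhdsWithin]
    have : (nhdsWithin t (S ∩ Ioi t)).NeBot := ⟨fun h => ht ⟨hFt, h⟩⟩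
    exact this.mono (nhdsWithin_mono _ fun s hs => ⟨hs.1, ne_of_gt hs.2⟩)
  have h0 : HasDerivWithinAt F 0 S t :=
    (hasDerivWithinAt_const t S (0 : ℝ)).congr (fun s hs => hs) hFt
  exact hacc.uniqueDiffWithinAt.eq_deriv S hd.hasDerivWithinAt h0

end Real

section EReal

theorem abs_coe_sub_coe (a b : ℝ) : ((a : EReal) - (b : EReal)).abs = ENNReal.ofReal |a - b| := by
  rw [← EReal.coe_sub, EReal.abs_def]

theorem isFinite_of_abs_sub_lt_top {a b : EReal} (h : (a - b).abs < ∞) :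
    (a ≠ ⊤ ∧ a ≠ ⊥) ∧ b ≠ ⊤ ∧ b ≠ ⊥ := by
  induction a <;> induction b <;> simp_all

end EReal

/-! ### Absolute continuity along a curve. -/

variable {X : Type*} [MetricSpace X]

/-- `f` is real-valued and absolutely continuous along `γ`, with derivative bounded by `g`. -/
structure AbsContAlong (f : X → EReal) (g : X → ℝ≥0∞) (γ : Curve X) : Prop where
  finite : ∀ t ∈ Icc 0 γ.length, f (γ.toFun t) ≠ ⊤ ∧ f (γ.toFun t) ≠ ⊥
  absCont : AbsolutelyContinuousOnInterval (fun t => (f (γ.toFun t)).toReal) 0 γ.length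
  deriv_le : ∀ᵐ t ∂volume.restrict (Icc 0 γ.length),
    ‖deriv (fun t => (f (γ.toFun t)).toReal) t‖ₑ ≤ g (γ.toFun t)

namespace AbsContAlong

variable {f : X → EReal} {g g' : X → ℝ≥0∞} {γ : Curve X}

theorem coe_toReal (h : AbsContAlong f g γ) {t : ℝ} (ht : t ∈ Icc 0 γ.length) :
    ((f (γ.toFun t)).toReal : EReal) = f (γ.toFun t) :=
  EReal.coe_toReal (h.finite t ht).1 (h.finite t ht).2

theorem upperGradientIneq (h : AbsContAlong f g γ) : UpperGradientIneq g f γ := by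
  have hl := γ.length_pos.le
  unfold UpperGradientIneq
  rw [← h.coe_toReal ⟨le_rfl, hl⟩, ← h.coe_toReal ⟨hl, le_rfl⟩, abs_coe_sub_coe]
  exact AbsolutelyContinuousOnInterval.ofReal_abs_sub_le hl h.absCont h.deriv_le

theorem mono (h : AbsContAlong f g γ)
    (hg : ∀ᵐ t ∂volume.restrict (Icc 0 γ.length), g (γ.toFun t) ≤ g' (γ.toFun t)) :
    AbsContAlong f g' γ :=
  ⟨h.finite, h.absCont, by filter_upwards [h.deriv_le, hg] with t h1 h2 using h1.trans h2⟩

theorem min (h : AbsContAlong f g γ) (h' : AbsContAlong f g' γ) :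
    AbsContAlong f (fun x => g x ⊓ g' x) γ :=
  ⟨h.finite, h.absCont, by filter_upwards [h.deriv_le, h'.deriv_le] with t h1 h2 using le_inf h1 h2⟩

theorem iInf {g : ℕ → X → ℝ≥0∞} (h : ∀ n, AbsContAlong f (g n) γ) :
    AbsContAlong f (fun x => ⨅ n, g n x) γ :=
  ⟨(h 0).finite, (h 0).absCont, by
    filter_upwards [ae_all_iff.2 fun n => (h n).deriv_le] with t ht using le_iInf ht⟩

theorem of_upperGradientIneq [MeasurableSpace X] [BorelSpace X] (hg : Measurable g)
    (hfin : γ.integral g < ∞) (h : ∀ σ : Curve X, σ.IsSub γ → UpperGradientIneq g f σ) :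
    AbsContAlong f g γ := by
  have key : ∀ s t, 0 ≤ s → s < t → t ≤ γ.length →
      (f (γ.toFun s) - f (γ.toFun t)).abs ≤ ∫⁻ r in Icc s t, g (γ.toFun r) := by
    intro s t hs hst ht
    obtain ⟨σ, hσl, hσ⟩ := γ.exists_sub hs hst ht
    have := h σ ⟨s, hs, by rw [hσl]; linarith, hσ⟩
    rw [UpperGradientIneq, Curve.integral_sub hσ, hσ, hσ, hσl] at this
    simpa using this
  have hlt : ∀ s t, 0 ≤ s → s < t → t ≤ γ.length →
      (f (γ.toFun s) - f (γ.toFun t)).abs < ∞ := fun s t hs hst ht =>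
    (key s t hs hst ht).trans_lt ((lintegral_mono_set (Icc_subset_Icc hs ht)).trans_lt hfin)
  have hfinite : ∀ t ∈ Icc 0 γ.length, f (γ.toFun t) ≠ ⊤ ∧ f (γ.toFun t) ≠ ⊥ := by
    intro t ht
    -- Each point is an end point of a subcurve with finite integral. For `t = 0` the subcurve over
    -- `[0, t]` degenerates, and the whole curve takes its place.
    rcases ht.1.eq_or_lt with rfl | h0
    · exact (isFinite_of_abs_sub_lt_top (hlt 0 γ.length le_rfl γ.length_pos le_rfl)).1
    · exact (isFinite_of_abs_sub_lt_top (hlt 0 t le_rfl h0 ht.2)).2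
  obtain ⟨h1, h2⟩ := absolutelyContinuous_of_le_lintegral
    (F := fun t => (f (γ.toFun t)).toReal) (G := fun t => g (γ.toFun t)) γ.length_pos.le
    (γ.aemeasurable_comp hg) hfin fun s t hs hst ht => by
      have hs' := hfinite s ⟨hs, by linarith⟩
      have ht' := hfinite t ⟨by linarith, ht⟩
      rw [← abs_coe_sub_coe, EReal.coe_toReal hs'.1 hs'.2, EReal.coe_toReal ht'.1 ht'.2]
      exact key s t hs hst ht
  exact ⟨hfinite, h1, h2⟩

end AbsContAlong

/-! ### Weak upper gradients, Dirichlet and Newtonian spaces. -/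

variable [MeasurableSpace X] {μ : Measure X} {p : ℝ} {E : Set X} {f : X → EReal}
  {g g' : X → ℝ≥0∞}

theorem isWeakUpperGradient_iff (hp : 0 < p) :
    IsWeakUpperGradient μ p E g f ↔
      AEMeasurable g (μ.restrict E) ∧ AEAlong μ p E (UpperGradientIneq g f) := by
  rw [IsWeakUpperGradient, AEAlong, exceptional_iff_pModulus_eq_zero hp]

theorem IsWeakUpperGradient.of_absContAlong (hp : 0 < p) (hg : AEMeasurable g (μ.restrict E))
    (h : AEAlong μ p E (AbsContAlong f g)) : IsWeakUpperGradient μ p E g f :=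
  (isWeakUpperGradient_iff hp).2 ⟨hg, h.mono fun _ _ => AbsContAlong.upperGradientIneq⟩

theorem IsUpperGradient.isWeakUpperGradient (hp : 0 < p) (h : IsUpperGradient E g f) :
    IsWeakUpperGradient μ p E g f :=
  (isWeakUpperGradient_iff hp).2 ⟨h.1.aemeasurable, AEAlong.of_forall h.2 hp⟩

theorem IsWeakUpperGradient.of_subset {F : Set X} (hEF : E ⊆ F) (hp : 0 < p)
    (h : IsWeakUpperGradient μ p F g f) : IsWeakUpperGradient μ p E g f := by
  rw [isWeakUpperGradient_iff hp] at h ⊢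
  exact ⟨h.1.mono_measure (Measure.restrict_mono hEF le_rfl), h.2.of_subset hEF⟩

theorem IsUpperGradient.of_subset {F : Set X} (hEF : E ⊆ F) (h : IsUpperGradient F g f) :
    IsUpperGradient E g f :=
  ⟨h.1, fun γ hγ => h.2 γ (hγ.mono hEF)⟩

theorem MemDirichlet.of_subset {F : Set X} (hEF : E ⊆ F) (h : MemDirichlet μ p F f) :
    MemDirichlet μ p E f := by
  obtain ⟨h1, g, h2, h3⟩ := h
  exact ⟨h1.mono_measure (Measure.restrict_mono hEF le_rfl), g, h2.of_subset hEF,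
    (lintegral_mono_set hEF).trans_lt h3⟩

theorem LocallyPIntegrable.of_lintegral_lt_top (h : ∫⁻ x in E, g x ^ p ∂μ < ∞) :
    LocallyPIntegrable μ p E g := fun x hx =>
  ⟨x, hx, 1, mem_ball_self one_pos, (lintegral_mono_set inter_subset_right).trans_lt h⟩

theorem LocallyPIntegrable.congr (h : LocallyPIntegrable μ p E g)
    (hg : g =ᵐ[μ.restrict E] g') : LocallyPIntegrable μ p E g' := by
  intro x hx
  obtain ⟨c, hc, r, hr, hfin⟩ := h x hx
  refine ⟨c, hc, r, hr, ?_⟩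
  rwa [lintegral_congr_ae (g := fun y => g y ^ p)]
  filter_upwards [ae_restrict_of_ae_restrict_of_subset inter_subset_right hg] with y hy
  rw [hy]

theorem MemDirichlet.memDirichletLoc (h : MemDirichlet μ p E f) : MemDirichletLoc μ p E f :=
  fun x hx => ⟨x, hx, 1, mem_ball_self one_pos, h.of_subset inter_subset_right⟩

theorem MemDirichlet.exists_isWeakUpperGradient (hp : 0 < p) (h : MemDirichlet μ p E f) :
    ∃ g, IsWeakUpperGradient μ p E g f ∧ ∫⁻ x in E, g x ^ p ∂μ < ∞ := by
  obtain ⟨_, g, hg, hfin⟩ := h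
  exact ⟨g, hg.isWeakUpperGradient hp, hfin⟩

theorem minimalGradient_spec (h : ∃ k, IsMinimalWeakUpperGradient μ p E k f) :
    IsMinimalWeakUpperGradient μ p E (minimalGradient μ p E f) f := by
  rw [minimalGradient, dif_pos h]
  exact h.choose_spec

theorem newtonianNorm_lt_top_iff (hp : 0 < p) :
    newtonianNorm μ p E f < ∞ ↔ ∫⁻ x in E, (f x).abs ^ p ∂μ < ∞ ∧ energy μ p E f < ∞ := by
  rw [newtonianNorm, ENNReal.rpow_lt_top_iff_of_pos (by positivity), ENNReal.add_lt_top]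

theorem newtonianNorm_rpow (hp : 0 < p) :
    newtonianNorm μ p E f ^ p = ∫⁻ x in E, (f x).abs ^ p ∂μ + energy μ p E f := by
  rw [newtonianNorm, one_div, ENNReal.rpow_inv_rpow hp.ne']

theorem MemDirichletLoc.aemeasurable [SecondCountableTopology X] (h : MemDirichletLoc μ p E f) :
    AEMeasurable f (μ.restrict E) := by
  choose! c hc r hr hD using h
  obtain ⟨T, hTE, hT, hcov⟩ := TopologicalSpace.countable_cover_nhdsWithin
    (f := fun x => ball (c x) (r x)) (s := E)
    (fun x hx => mem_nhdsWithin_of_mem_nhds (isOpen_ball.mem_nhds (hr x hx)))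
  have : Countable T := hT.to_subtype
  have h1 : AEMeasurable f (μ.restrict (⋃ x : T, ball (c x) (r x) ∩ E)) :=
    aemeasurable_iUnion_iff.2 fun x => (hD x (hTE x.2)).1
  refine h1.mono_measure (Measure.restrict_mono (fun x hx => ?_) le_rfl)
  obtain ⟨y, hy, hxy⟩ := mem_iUnion₂.1 (hcov hx)
  exact mem_iUnion.2 ⟨⟨y, hy⟩, hxy, hx⟩

section Borel

variable [BorelSpace X]

/-- A Borel representative `k` of `g` has the same integral along almost every curve and all its
subcurves, so the upper gradient inequality holds on all subcurves at once. -/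
theorem IsWeakUpperGradient.absContAlong [SecondCountableTopology X] (hp : 0 < p)
    (h : IsWeakUpperGradient μ p E g f) (hg : LocallyPIntegrable μ p E g) :
    AEAlong μ p E (AbsContAlong f g) := by
  obtain ⟨hm, hA⟩ := (isWeakUpperGradient_iff hp).1 h
  obtain ⟨k, hk, hgk⟩ := hm
  have h1 := AEAlong.ae_of_ae hp hgk
  have h2 : AEAlong μ p E fun γ => UpperGradientIneq k f γ ∧
      ∀ᵐ t ∂volume.restrict (Icc 0 γ.length), g (γ.toFun t) = k (γ.toFun t) :=
    (hA.and hp h1).mono fun γ _ hγ => ⟨by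
      have : γ.integral g = γ.integral k := lintegral_congr_ae hγ.2
      have h3 := hγ.1
      rwa [UpperGradientIneq, this] at h3, hγ.2⟩
  refine ((AEAlong.integral_lt_top_of_locally hp hk (hg.congr hgk)).and hp h2.sub).mono
    fun γ _ hγ => ?_
  refine (AbsContAlong.of_upperGradientIneq hk hγ.1 fun σ hσ => (hγ.2 σ hσ).1).mono ?_
  filter_upwards [(hγ.2 γ γ.isSub_refl).2] with t ht using ht.ge

/-- Adding an `L^p` function with infinite integral along the exceptional curves turns a Borel
representative of `g` into a genuine upper gradient. -/
theorem MemDirichlet.of_isWeakUpperGradient (hp : 1 ≤ p) (hf : AEMeasurable f (μ.restrict E))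
    (h : IsWeakUpperGradient μ p E g f) (hfin : ∫⁻ x in E, g x ^ p ∂μ < ∞) :
    MemDirichlet μ p E f := by
  have hp0 : 0 < p := by linarith
  obtain ⟨hm, hA⟩ := (isWeakUpperGradient_iff hp0).1 h
  obtain ⟨k, hk, hgk⟩ := hm
  obtain ⟨ρ, hρ, hρfin, hΓ⟩ := hA.and hp0 (AEAlong.ae_of_ae hp0 hgk)
  refine ⟨hf, fun x => k x + ρ x, ⟨hk.add hρ, fun γ hγ => ?_⟩, ?_⟩
  · by_cases hE : UpperGradientIneq g f γ ∧
        ∀ᵐ t ∂volume.restrict (Icc 0 γ.length), g (γ.toFun t) = k (γ.toFun t)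
    · refine hE.1.trans ?_
      rw [Curve.integral, lintegral_congr_ae hE.2]
      exact γ.integral_mono fun x => le_self_add
    · refine le_trans le_top ((hΓ γ ⟨hγ, hE⟩).symm.le.trans ?_)
      exact γ.integral_mono fun x => le_add_self
  · refine ENNReal.lintegral_rpow_add_lt_top_of_lintegral_rpow_lt_top hk.aemeasurable ?_
      hρfin hp
    rwa [lintegral_congr_ae (g := fun x => g x ^ p)]
    filter_upwards [hgk] with x hx
    rw [hx]

variable [SecondCountableTopology X]

/-- An a.e. bound on the derivative along curves survives countable infima, so the infimum of an
energy-minimizing sequence is again a weak upper gradient. -/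
theorem exists_isMinimalWeakUpperGradient (hp : 0 < p) (h : IsWeakUpperGradient μ p E g f)
    (hfin : ∫⁻ x in E, g x ^ p ∂μ < ∞) : ∃ k, IsMinimalWeakUpperGradient μ p E k f := by
  set S : Set ℝ≥0∞ := {a | a < ∞ ∧ ∃ k, IsWeakUpperGradient μ p E k f ∧ ∫⁻ x in E, k x ^ p ∂μ = a}
  have hS : S.Nonempty := ⟨_, hfin, g, h, rfl⟩
  obtain ⟨a, -, hlim, haS⟩ := exists_seq_tendsto_sInf hS (OrderBot.bddBelow S)
  have haS' := haS 0
  choose hafin k hk hka using haS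
  have hkA : ∀ n, AEAlong μ p E (AbsContAlong f (k n)) := fun n =>
    (hk n).absContAlong hp (.of_lintegral_lt_top (by rw [hka]; exact hafin n))
  set K : X → ℝ≥0∞ := fun x => ⨅ n, k n x
  have hKm : AEMeasurable K (μ.restrict E) := AEMeasurable.iInf fun n => (hk n).1
  have hKA : AEAlong μ p E (AbsContAlong f K) :=
    (AEAlong.all hp hkA).mono fun γ _ hγ => AbsContAlong.iInf hγ
  have hKle : ∫⁻ x in E, K x ^ p ∂μ ≤ sInf S := by
    refine ge_of_tendsto' hlim fun n => ?_
    rw [← hka n]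
    exact lintegral_mono fun x => ENNReal.rpow_le_rpow (iInf_le _ n) hp.le
  have hKfin : ∫⁻ x in E, K x ^ p ∂μ < ∞ :=
    hKle.trans_lt ((sInf_le haS').trans_lt (hafin 0))
  refine ⟨K, IsWeakUpperGradient.of_absContAlong hp hKm hKA, .of_lintegral_lt_top hKfin, fun g' hg' hloc => ?_⟩
  -- The minimum with any competitor is again admissible. Its energy cannot drop below the infimum,
  -- so it equals `K` a.e.
  have hminA : AEAlong μ p E (AbsContAlong f fun x => K x ⊓ g' x) :=
    (hKA.and hp (hg'.absContAlong hp hloc)).mono fun γ _ hγ => hγ.1.min hγ.2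
  have hminle : ∀ x, (K x ⊓ g' x) ^ p ≤ K x ^ p := fun x =>
    ENNReal.rpow_le_rpow inf_le_left hp.le
  have hminfin : ∫⁻ x in E, (K x ⊓ g' x) ^ p ∂μ < ∞ := (lintegral_mono hminle).trans_lt hKfin
  have hmem : sInf S ≤ ∫⁻ x in E, (K x ⊓ g' x) ^ p ∂μ :=
    sInf_le ⟨hminfin, _, IsWeakUpperGradient.of_absContAlong hp (hKm.inf hg'.1) hminA, rfl⟩
  filter_upwards [ae_eq_of_ae_le_of_lintegral_le (Filter.Eventually.of_forall hminle) hminfin.ne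
    (hKm.pow_const p) (hKle.trans hmem)] with x hx
  exact inf_eq_left.1 (ENNReal.rpow_left_injective hp.ne' hx)

theorem energy_le_lintegral (hp : 0 < p) (h : IsWeakUpperGradient μ p E g f)
    (hfin : ∫⁻ x in E, g x ^ p ∂μ < ∞) : energy μ p E f ≤ ∫⁻ x in E, g x ^ p ∂μ := by
  have := minimalGradient_spec (exists_isMinimalWeakUpperGradient hp h hfin)
  refine lintegral_mono_ae ?_
  filter_upwards [this.2.2 g h (.of_lintegral_lt_top hfin)] with x hx
  exact ENNReal.rpow_le_rpow hx hp.le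

theorem MemDirichlet.minimalGradient_isWeakUpperGradient (hp : 0 < p)
    (h : MemDirichlet μ p E f) : IsWeakUpperGradient μ p E (minimalGradient μ p E f) f := by
  obtain ⟨g, hg, hfin⟩ := h.exists_isWeakUpperGradient hp
  exact (minimalGradient_spec (exists_isMinimalWeakUpperGradient hp hg hfin)).1

theorem MemDirichlet.energy_lt_top (hp : 0 < p) (h : MemDirichlet μ p E f) :
    energy μ p E f < ∞ := by
  obtain ⟨g, hg, hfin⟩ := h.exists_isWeakUpperGradient hp
  exact (energy_le_lintegral hp hg hfin).trans_lt hfin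

theorem memNewtonian_iff (hp : 1 ≤ p) (hE : μ E ≠ 0) :
    MemNewtonian μ p E f ↔ MemDirichlet μ p E f ∧ ∫⁻ x in E, (f x).abs ^ p ∂μ < ∞ := by
  have hp0 : 0 < p := by linarith
  rw [MemNewtonian, newtonianNorm_lt_top_iff hp0]
  constructor
  · rintro ⟨hloc, hint, hen⟩
    refine ⟨?_, hint⟩
    by_cases hex : ∃ k, IsMinimalWeakUpperGradient μ p E k f
    · exact .of_isWeakUpperGradient hp hloc.aemeasurable (minimalGradient_spec hex).1 hen
    -- Without a minimal gradient the default value `∞` makes the energy infinite, since `μ E ≠ 0`.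
    · rw [energy, minimalGradient, dif_neg hex] at hen
      simp [hp0, hE] at hen
  · rintro ⟨hD, hint⟩
    exact ⟨hD.memDirichletLoc, hint, hD.energy_lt_top hp0⟩

end Borel

end MetricObstacle

namespace MetricObstacle

theorem AEMeasurable.ereal_sub {α : Type*} [MeasurableSpace α] {μ : Measure α} {f g : α → EReal}
    (hf : AEMeasurable f μ) (hg : AEMeasurable g μ) : AEMeasurable (fun x => f x - g x) μ := by
  simp only [sub_eq_add_neg]
  exact hf.add (continuous_neg.measurable.comp_aemeasurable hg)

theorem aemeasurable_piecewise_of_subset {α β : Type*} [MeasurableSpace α] [MeasurableSpace β]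
    {μ : Measure α} {f g : α → β} {s t : Set α} [DecidablePred (· ∈ s)] (hs : MeasurableSet s)
    (hf : AEMeasurable f (μ.restrict s)) (hg : AEMeasurable g (μ.restrict t)) (hst : s ⊆ t) :
    AEMeasurable (s.piecewise f g) (μ.restrict t) := by
  rw [← union_sdiff_cancel hst, aemeasurable_union_iff]
  constructor
  · exact hf.congr ((ae_restrict_mem hs).mono fun x hx => (piecewise_eq_of_mem s f g hx).symm)
  · rw [sdiff_eq_compl_inter, ← Measure.restrict_restrict hs.compl]
    exact hg.restrict.congr ((ae_restrict_mem hs.compl).mono fun x hx =>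
      (piecewise_eq_of_notMem s f g hx).symm)

open Classical in
theorem lintegral_piecewise_rpow {X : Type*} [MeasurableSpace X] {μ : Measure X} {p : ℝ} {Ω V : Set X}
    (hV : MeasurableSet V) (hVΩ : V ⊆ Ω) (g k : X → ℝ≥0∞) :
    ∫⁻ x in Ω, V.piecewise g k x ^ p ∂μ = ∫⁻ x in V, g x ^ p ∂μ + ∫⁻ x in Ω \ V, k x ^ p ∂μ := by
  rw [← lintegral_inter_add_sdiff _ Ω hV, inter_eq_self_of_subset_right hVΩ]
  congr 1
  · refine setLIntegral_congr_fun hV fun x hx => ?_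
    simp only [piecewise_eq_of_mem _ _ _ hx]
  · rw [sdiff_eq_compl_inter, ← Measure.restrict_restrict hV.compl]
    refine setLIntegral_congr_fun hV.compl fun x hx => ?_
    simp only [piecewise_eq_of_notMem _ _ _ hx]

theorem eq_coe_add_of_sub_eq_coe {a : EReal} {b c : ℝ} (h : a - b = c) :
    a = ((b + c : ℝ) : EReal) := by
  induction a with
  | bot => simp at h
  | top => simp at h
  | coe a =>
    norm_cast at h ⊢
    linarith

/-! ### Sums, maxima and pasting along a curve. -/

variable {X : Type*} [MetricSpace X]

namespace AbsContAlong

variable {f : X → EReal} {g : X → ℝ≥0∞} {γ : Curve X}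

theorem of_eq_coe {F : ℝ → ℝ} (hF : AbsolutelyContinuousOnInterval F 0 γ.length)
    (hf : ∀ t ∈ Icc 0 γ.length, f (γ.toFun t) = F t)
    (hd : ∀ᵐ t ∂volume.restrict (Icc 0 γ.length), ‖deriv F t‖ₑ ≤ g (γ.toFun t)) :
    AbsContAlong f g γ := by
  have heq : ∀ t ∈ Icc 0 γ.length, (f (γ.toFun t)).toReal = F t := fun t ht => by
    rw [hf t ht, EReal.toReal_coe]
  refine ⟨fun t ht => by simp [hf t ht], ?_, ?_⟩
  · refine absolutelyContinuousOnInterval_of_dist_le hF ?_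
    rw [uIcc_of_le γ.length_pos.le]
    exact fun s hs t ht => by simp only [heq s hs, heq t ht, le_refl]
  · filter_upwards [hd, ae_restrict_Icc_mem_Ioo 0 γ.length] with t ht htI
    rwa [Filter.EventuallyEq.deriv_eq]
    filter_upwards [Icc_mem_nhds htI.1 htI.2] with s hs using heq s hs

theorem of_eq_zero (hf : ∀ t ∈ Icc 0 γ.length, f (γ.toFun t) = 0) :
    AbsContAlong f (fun _ => 0) γ := by
  refine of_eq_coe (F := fun _ => 0) ?_ (by simpa using hf) (by simp)
  exact (LipschitzWith.const (0 : ℝ)).lipschitzOnWith.absolutelyContinuousOnInterval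

theorem of_eq_coe_add {f₁ f₂ : X → EReal} {g₁ g₂ : X → ℝ≥0∞} (h₁ : AbsContAlong f₁ g₁ γ)
    (h₂ : AbsContAlong f₂ g₂ γ) (hf : ∀ t ∈ Icc 0 γ.length,
      f (γ.toFun t) = (((f₁ (γ.toFun t)).toReal + (f₂ (γ.toFun t)).toReal : ℝ) : EReal)) :
    AbsContAlong f (fun x => g₁ x + g₂ x) γ := by
  refine of_eq_coe (h₁.absCont.add h₂.absCont) hf ?_
  filter_upwards [h₁.deriv_le, h₂.deriv_le,
    AbsolutelyContinuousOnInterval.ae_hasDerivAt γ.length_pos.le h₁.absCont,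
    AbsolutelyContinuousOnInterval.ae_hasDerivAt γ.length_pos.le h₂.absCont] with t h1 h2 h3 h4
  rw [(h3.add h4).deriv]
  exact (enorm_add_le _ _).trans (add_le_add h1 h2)

theorem sup {f₁ f₂ : X → EReal} {g₁ g₂ : X → ℝ≥0∞} (h₁ : AbsContAlong f₁ g₁ γ)
    (h₂ : AbsContAlong f₂ g₂ γ) :
    UpperGradientIneq (fun x => g₁ x ⊔ g₂ x) (fun x => f₁ x ⊔ f₂ x) γ := by
  have h1 := h₁.upperGradientIneq
  have h2 := h₂.upperGradientIneq
  have hl : (0 : ℝ) ∈ Icc 0 γ.length := ⟨le_rfl, γ.length_pos.le⟩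
  have hr : γ.length ∈ Icc 0 γ.length := ⟨γ.length_pos.le, le_rfl⟩
  unfold UpperGradientIneq at *
  rw [← h₁.coe_toReal hl, ← h₁.coe_toReal hr, abs_coe_sub_coe] at h1
  rw [← h₂.coe_toReal hl, ← h₂.coe_toReal hr, abs_coe_sub_coe] at h2
  beta_reduce
  rw [← h₁.coe_toReal hl, ← h₁.coe_toReal hr, ← h₂.coe_toReal hl, ← h₂.coe_toReal hr,
    ← EReal.coe_strictMono.monotone.map_max, ← EReal.coe_strictMono.monotone.map_max,
    abs_coe_sub_coe]
  refine (ENNReal.ofReal_le_ofReal (abs_max_sub_max_le_max _ _ _ _)).trans ?_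
  rw [ENNReal.ofReal_max]
  exact max_le (h1.trans (γ.integral_mono fun _ => le_sup_left))
    (h2.trans (γ.integral_mono fun _ => le_sup_right))

/-- Replacing `u` by `v = u + h` in the open set `V`, where `h` vanishes outside `V`, replaces the
bound `gu` for the derivative by `gv` in `V`. -/
theorem piecewise {u v h : X → EReal} {gu gv gh : X → ℝ≥0∞} {V : Set X} (hV : IsOpen V)
    [DecidablePred (· ∈ V)] (hu : AbsContAlong u gu γ) (hh : AbsContAlong h gh γ)
    (hzero : ∀ x ∉ V, h x = 0) (hsub : ∀ x ∈ V, h x = v x - u x)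
    (hv : ∀ σ : Curve X, σ.IsSub γ → σ.InSet V → AbsContAlong v gv σ) :
    AbsContAlong (V.piecewise v u) (V.piecewise gv gu) γ := by
  have hl := γ.length_pos.le
  set w := V.piecewise v u
  -- Along the curve `u` and `h` are finite, so `v - u = h` forces `v = u + h` in `V`.
  have hw : ∀ t ∈ Icc 0 γ.length, w (γ.toFun t) =
      (((u (γ.toFun t)).toReal + (h (γ.toFun t)).toReal : ℝ) : EReal) := by
    intro t ht
    by_cases htV : γ.toFun t ∈ V
    · have h1 := hsub _ htV
      rw [← hu.coe_toReal ht, ← hh.coe_toReal ht] at h1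
      rw [← eq_coe_add_of_sub_eq_coe h1.symm]
      exact piecewise_eq_of_mem _ _ _ htV
    · rw [hzero _ htV, EReal.toReal_zero, add_zero, hu.coe_toReal ht]
      exact piecewise_eq_of_notMem _ _ _ htV
  have hW := hu.of_eq_coe_add hh hw
  refine ⟨hW.finite, hW.absCont, ?_⟩
  -- Rational end points leave only countably many null sets to discard.
  have hin : ∀ a b : ℚ, ∀ᵐ t ∂(volume : Measure ℝ), t ∈ Ioo (a : ℝ) b → 0 ≤ (a : ℝ) →
      (b : ℝ) ≤ γ.length → (∀ s ∈ Icc (a : ℝ) b, γ.toFun s ∈ V) →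
      ‖deriv (fun t => (w (γ.toFun t)).toReal) t‖ₑ ≤ gv (γ.toFun t) := by
    intro a b
    by_cases H : 0 ≤ (a : ℝ) ∧ (a : ℝ) < b ∧ (b : ℝ) ≤ γ.length ∧
        ∀ s ∈ Icc (a : ℝ) b, γ.toFun s ∈ V
    · obtain ⟨ha, hab, hb, hsV⟩ := H
      obtain ⟨σ, hσl, hσ⟩ := γ.exists_sub ha hab hb
      have hd := (hv σ ⟨a, ha, by rw [hσl]; linarith, hσ⟩ (fun t ht => by
        rw [hσl] at ht
        rw [hσ]
        exact hsV _ ⟨by linarith [ht.1], by linarith [ht.2]⟩)).deriv_le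
      rw [hσl, ae_restrict_iff' measurableSet_Icc] at hd
      filter_upwards [(measurePreserving_add_left volume (-(a : ℝ))).quasiMeasurePreserving.ae hd]
        with t ht htI _ _ _
      have h1 := ht ⟨by linarith [htI.1], by linarith [htI.2]⟩
      simp only [hσ] at h1
      rw [deriv_comp_const_add (fun s => (v (γ.toFun s)).toReal) (a : ℝ),
        add_neg_cancel_left] at h1
      rwa [Filter.EventuallyEq.deriv_eq (f := fun s => (w (γ.toFun s)).toReal)] at h1
      filter_upwards [Icc_mem_nhds htI.1 htI.2] with s hs
      simp only [w, piecewise_eq_of_mem _ _ _ (hsV s hs)]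
    · exact Filter.Eventually.of_forall fun t ht ha hb hsV =>
        absurd ⟨ha, ht.1.trans ht.2, hb, hsV⟩ H
  filter_upwards [hu.deriv_le,
    AbsolutelyContinuousOnInterval.ae_hasDerivAt hl hu.absCont,
    AbsolutelyContinuousOnInterval.ae_hasDerivAt hl hh.absCont,
    ae_deriv_eq_zero_of_eq_zero hl hh.absCont, ae_restrict_Icc_mem_Ioo 0 γ.length,
    ae_restrict_of_ae (ae_all_iff.2 fun a => ae_all_iff.2 (hin a))] with t h1 h2 h3 h4 htI h5
  by_cases htV : γ.toFun t ∈ V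
  · rw [piecewise_eq_of_mem _ _ _ htV]
    obtain ⟨a, b, ha, -, hb, -, htab, hsV⟩ :=
      γ.exists_sub_of_mem_open hV (Ioo_subset_Icc_self htI) htV
    obtain ⟨c, hac, hct⟩ := exists_rat_btwn (htab htI).1
    obtain ⟨d, htd, hdb⟩ := exists_rat_btwn (htab htI).2
    exact h5 c d ⟨hct, htd⟩ (by linarith) (by linarith)
      fun s hs => hsV s ⟨by linarith [hs.1], by linarith [hs.2]⟩
  -- Outside `V` the function `h` vanishes, so its derivative is zero at almost every such
  -- parameter, and only the derivative of `u` remains.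
  · rw [piecewise_eq_of_notMem _ _ _ htV]
    have heq : (fun t => (w (γ.toFun t)).toReal) =ᶠ[nhds t]
        (fun t => (u (γ.toFun t)).toReal) + fun t => (h (γ.toFun t)).toReal := by
      filter_upwards [Icc_mem_nhds htI.1 htI.2] with s hs
      rw [hw s hs, EReal.toReal_coe]
      rfl
    rw [heq.deriv_eq, (h2.add h3).deriv, h4 (by rw [hzero _ htV, EReal.toReal_zero]), add_zero]
    exact h1

end AbsContAlong

/-! ### Capacity zero sets. -/

variable [MeasurableSpace X] {μ : Measure X} {p : ℝ}

theorem capacity_mono {E F : Set X} (h : E ⊆ F) : capacity μ p E ≤ capacity μ p F :=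
  iInf_mono fun _ => iInf_mono fun _ => le_iInf fun hF => iInf_le_of_le (fun x hx => hF x (h hx))
    le_rfl

variable [BorelSpace X] [SecondCountableTopology X]

theorem capacity_empty (hp : 1 ≤ p) (hμ : μ univ ≠ 0) : capacity μ p (∅ : Set X) = 0 := by
  have hp0 : 0 < p := by linarith
  have h0 : IsWeakUpperGradient μ p univ (fun _ => 0) (fun _ : X => (0 : EReal)) :=
    .of_absContAlong hp0 aemeasurable_const
      (.of_forall (fun γ _ => AbsContAlong.of_eq_zero fun _ _ => rfl) hp0)
  have hint : ∫⁻ _ in (univ : Set X), (0 : ℝ≥0∞) ^ p ∂μ = 0 := by simp [hp0]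
  have hN : MemNewtonian μ p univ (fun _ : X => (0 : EReal)) := by
    rw [memNewtonian_iff hp hμ]
    exact ⟨.of_isWeakUpperGradient hp aemeasurable_const h0 (by rw [hint]; simp), by simp [hp0]⟩
  refine le_antisymm (iInf_le_of_le _ (iInf_le_of_le hN (iInf_le_of_le (by simp) ?_))) bot_le
  rw [newtonianNorm_rpow hp0]
  have := energy_le_lintegral hp0 h0 (by rw [hint]; simp)
  rw [hint] at this
  rw [le_antisymm this bot_le]
  simp [hp0]

/-- The maximum of two test functions is a test function for the union, with norm and energy bounded
by the sums. -/
theorem capacity_union_eq_zero (hp : 1 ≤ p) (hμ : μ univ ≠ 0) {E F : Set X}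
    (hE : capacity μ p E = 0) (hF : capacity μ p F = 0) : capacity μ p (E ∪ F) = 0 := by
  have hp0 : 0 < p := by linarith
  refine le_antisymm (ENNReal.le_of_forall_pos_le_add fun ε hε _ => ?_) bot_le
  rw [zero_add]
  have key : ∀ {A : Set X}, capacity μ p A = 0 → ∃ u, MemDirichlet μ p univ u ∧
      (∀ x ∈ A, 1 ≤ u x) ∧
      ∫⁻ x in univ, (u x).abs ^ p ∂μ + energy μ p univ u ≤ (ε : ℝ≥0∞) / 2 := by
    intro A hA
    have hlt : capacity μ p A < (ε : ℝ≥0∞) / 2 := by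
      rw [hA]; exact ENNReal.half_pos (by exact_mod_cast hε.ne')
    simp only [capacity, iInf_lt_iff] at hlt
    obtain ⟨u, h1, h2, h3⟩ := hlt
    rw [newtonianNorm_rpow hp0] at h3
    exact ⟨u, ((memNewtonian_iff hp hμ).1 h1).1, h2, h3.le⟩
  obtain ⟨u, hu, huE, hule⟩ := key hE
  obtain ⟨v, hv, hvF, hvle⟩ := key hF
  set gu := minimalGradient μ p univ u
  set gv := minimalGradient μ p univ v
  have hgu := hu.minimalGradient_isWeakUpperGradient hp0
  have hgv := hv.minimalGradient_isWeakUpperGradient hp0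
  have sup_rpow_le : ∀ a b : ℝ≥0∞, (a ⊔ b) ^ p ≤ a ^ p + b ^ p := fun a b => by
    rcases le_total a b with h | h
    · rw [sup_eq_right.2 h]; exact le_add_self
    · rw [sup_eq_left.2 h]; exact le_self_add
  have hA := (hgu.absContAlong hp0 (.of_lintegral_lt_top (hu.energy_lt_top hp0))).and hp0
    (hgv.absContAlong hp0 (.of_lintegral_lt_top (hv.energy_lt_top hp0)))
  have hweak : IsWeakUpperGradient μ p univ (fun x => gu x ⊔ gv x) (fun x => u x ⊔ v x) :=
    (isWeakUpperGradient_iff hp0).2 ⟨hgu.1.sup hgv.1, hA.mono fun γ _ hγ => hγ.1.sup hγ.2⟩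
  have hgle : ∫⁻ x in univ, (gu x ⊔ gv x) ^ p ∂μ ≤ energy μ p univ u + energy μ p univ v := by
    refine (lintegral_mono fun x => sup_rpow_le _ _).trans ?_
    rw [lintegral_add_left' (hgu.1.pow_const p)]
    rfl
  have hgfin := hgle.trans_lt (ENNReal.add_lt_top.2 ⟨hu.energy_lt_top hp0, hv.energy_lt_top hp0⟩)
  have habs : Measurable EReal.abs := by
    refine EReal.measurable_of_measurable_real ?_
    exact ENNReal.measurable_ofReal.comp measurable_norm
  have hfle : ∫⁻ x in univ, (u x ⊔ v x).abs ^ p ∂μ ≤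
      ∫⁻ x in univ, (u x).abs ^ p ∂μ + ∫⁻ x in univ, (v x).abs ^ p ∂μ := by
    rw [← lintegral_add_left' (f := fun x => (u x).abs ^ p)
      ((habs.comp_aemeasurable hu.1).pow_const p)]
    refine lintegral_mono fun x => ?_
    rcases le_total (u x) (v x) with h | h
    · simp only [sup_eq_right.2 h]; exact le_add_self
    · simp only [sup_eq_left.2 h]; exact le_self_add
  have htot : ∫⁻ x in univ, (u x ⊔ v x).abs ^ p ∂μ + energy μ p univ (fun x => u x ⊔ v x) ≤ ε :=
    calc _ ≤ (∫⁻ x in univ, (u x).abs ^ p ∂μ + ∫⁻ x in univ, (v x).abs ^ p ∂μ) +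
          (energy μ p univ u + energy μ p univ v) :=
          add_le_add hfle ((energy_le_lintegral hp0 hweak hgfin).trans hgle)
      _ = (∫⁻ x in univ, (u x).abs ^ p ∂μ + energy μ p univ u) +
          (∫⁻ x in univ, (v x).abs ^ p ∂μ + energy μ p univ v) := by abel
      _ ≤ ε / 2 + ε / 2 := add_le_add hule hvle
      _ = ε := ENNReal.add_halves _
  have hN : MemNewtonian μ p univ (fun x => u x ⊔ v x) := by
    rw [memNewtonian_iff hp hμ]
    exact ⟨.of_isWeakUpperGradient hp (hu.1.sup hv.1) hweak hgfin,
      (le_self_add.trans htot).trans_lt ENNReal.coe_lt_top⟩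
  refine iInf_le_of_le _ (iInf_le_of_le hN (iInf_le_of_le ?_ ?_))
  · rintro x (hx | hx)
    · exact (huE x hx).trans le_sup_left
    · exact (hvF x hx).trans le_sup_right
  · rwa [newtonianNorm_rpow hp0]

/-! ### Pasting competitors and restricting the obstacle problem. -/

variable {Ω V : Set X} {f u v ψ : X → EReal}

theorem MemDirichlet.absContAlong_minimalGradient (hp : 0 < p) (hu : MemDirichlet μ p V u) :
    AEAlong μ p V (AbsContAlong u (minimalGradient μ p V u)) :=
  (hu.minimalGradient_isWeakUpperGradient hp).absContAlong hp
    (.of_lintegral_lt_top (hu.energy_lt_top hp))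

/-- Almost no curve passes through a point of `V` where `u` is infinite. -/
theorem MemDirichlet.aeAlong_finite (hp : 0 < p) (hV : IsOpen V) (hu : MemDirichlet μ p V u)
    (E : Set X) : AEAlong μ p E fun γ => ∀ t ∈ Icc 0 γ.length, γ.toFun t ∈ V →
      u (γ.toFun t) ≠ ⊤ ∧ u (γ.toFun t) ≠ ⊥ := by
  refine ((hu.absContAlong_minimalGradient hp).sub_of_subset hp hV.measurableSet).mono
    fun γ _ hγ t ht htV => ?_
  obtain ⟨a, b, ha, hab, hb, htab, -, hsV⟩ := γ.exists_sub_of_mem_open hV ht htV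
  obtain ⟨σ, hσl, hσ⟩ := γ.exists_sub ha hab hb
  have h := (hγ σ ⟨a, ha, by rw [hσl]; linarith, hσ⟩ (fun s hs => by
    rw [hσl] at hs
    rw [hσ]
    exact hsV _ ⟨by linarith [hs.1], by linarith [hs.2]⟩)).finite (t - a)
    ⟨by linarith [htab.1], by rw [hσl]; linarith [htab.2]⟩
  rwa [hσ, add_sub_cancel] at h

/-- In `EReal` the difference `u - u` is not zero where `u` is infinite, but almost no curve meets
such a point of `V`. -/
theorem MemDirichlet.isWeakUpperGradient_indicator_sub_self (hp : 0 < p) (hV : IsOpen V)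
    (hu : MemDirichlet μ p V u) :
    IsWeakUpperGradient μ p univ (fun _ => 0) (V.indicator fun x => u x - u x) := by
  refine .of_absContAlong hp aemeasurable_const
    ((hu.aeAlong_finite hp hV univ).mono fun γ _ hγ => AbsContAlong.of_eq_zero fun t ht => ?_)
  by_cases htV : γ.toFun t ∈ V
  · rw [indicator_of_mem htV]
    exact EReal.sub_self (hγ t ht htV).1 (hγ t ht htV).2
  · exact indicator_of_notMem htV _

theorem MemDirichlet.indicator_sub_self (hp : 1 ≤ p) (hV : IsOpen V)
    (hu : MemDirichlet μ p V u) : MemDirichlet μ p univ (V.indicator fun x => u x - u x) := by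
  have hp0 : 0 < p := by linarith
  refine .of_isWeakUpperGradient hp ?_ (hu.isWeakUpperGradient_indicator_sub_self hp0 hV)
    (by simp [hp0])
  rw [Measure.restrict_univ]
  exact (aemeasurable_indicator_iff hV.measurableSet).2 (AEMeasurable.ereal_sub hu.1 hu.1)

theorem MemDirichlet.memDirichletZero_sub_self (hp : 1 ≤ p) (hV : IsOpen V)
    (hu : MemDirichlet μ p V u) : MemDirichletZero μ p V fun x => u x - u x :=
  ⟨_, hu.indicator_sub_self hp hV, fun _ hx => indicator_of_notMem hx _,
    fun _ hx => indicator_of_mem hx _⟩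

open Classical in
theorem isWeakUpperGradient_piecewise (hp : 0 < p) (hV : IsOpen V) (hVΩ : V ⊆ Ω)
    (hu : MemDirichlet μ p Ω u) (hv : MemDirichlet μ p V v)
    (hvu : MemDirichletZero μ p V fun x => v x - u x) :
    IsWeakUpperGradient μ p Ω (V.piecewise (minimalGradient μ p V v) (minimalGradient μ p Ω u))
      (V.piecewise v u) := by
  obtain ⟨h, hh, hzero, hsub⟩ := hvu
  refine .of_absContAlong hp (aemeasurable_piecewise_of_subset hV.measurableSet
    (hv.minimalGradient_isWeakUpperGradient hp).1 (hu.minimalGradient_isWeakUpperGradient hp).1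
    hVΩ) ?_
  have h1 := (hu.absContAlong_minimalGradient hp).and hp
    (((hh.absContAlong_minimalGradient hp).of_subset (subset_univ Ω)).and hp
      ((hv.absContAlong_minimalGradient hp).sub_of_subset hp hV.measurableSet))
  exact h1.mono fun γ _ hγ => hγ.1.piecewise hV hγ.2.1 hzero hsub hγ.2.2

open Classical in
theorem MemDirichlet.piecewise (hp : 1 ≤ p) (hV : IsOpen V) (hVΩ : V ⊆ Ω)
    (hu : MemDirichlet μ p Ω u) (hv : MemDirichlet μ p V v)
    (hvu : MemDirichletZero μ p V fun x => v x - u x) :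
    MemDirichlet μ p Ω (V.piecewise v u) := by
  have hp0 : 0 < p := by linarith
  refine .of_isWeakUpperGradient hp (aemeasurable_piecewise_of_subset hV.measurableSet hv.1 hu.1
    hVΩ) (isWeakUpperGradient_piecewise hp0 hV hVΩ hu hv hvu) ?_
  rw [lintegral_piecewise_rpow hV.measurableSet hVΩ, ENNReal.add_lt_top]
  exact ⟨hv.energy_lt_top hp0, (lintegral_mono_set sdiff_subset).trans_lt (hu.energy_lt_top hp0)⟩

-- With `k` and `h` the zero extensions of `u - f` and `v - u`, the new difference is `k + h` along
-- almost every curve, namely where `u` and `f` are finite.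
open Classical in
theorem memDirichletZero_piecewise_sub (hp : 1 ≤ p) (hΩ : IsOpen Ω) (hV : IsOpen V) (hVΩ : V ⊆ Ω)
    (hu : MemDirichlet μ p Ω u) (hv : MemDirichlet μ p V v) (hf : MemDirichlet μ p Ω f)
    (huf : MemDirichletZero μ p Ω fun x => u x - f x)
    (hvu : MemDirichletZero μ p V fun x => v x - u x) :
    MemDirichletZero μ p Ω fun x => V.piecewise v u x - f x := by
  have hp0 : 0 < p := by linarith
  have hw := hu.piecewise hp hV hVΩ hv hvu
  obtain ⟨h, hh, hzero, hsub⟩ := hvu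
  obtain ⟨k, hk, hkzero, hksub⟩ := huf
  beta_reduce at hsub hksub
  refine ⟨Ω.indicator fun x => V.piecewise v u x - f x, ?_, fun _ hx => indicator_of_notMem hx _,
    fun _ hx => indicator_of_mem hx _⟩
  have hhg := hh.minimalGradient_isWeakUpperGradient hp0
  have hkg := hk.minimalGradient_isWeakUpperGradient hp0
  refine .of_isWeakUpperGradient hp
    (g := fun x => minimalGradient μ p univ k x + minimalGradient μ p univ h x) ?_
    (.of_absContAlong hp0 (hkg.1.add hhg.1) ?_) ?_
  · rw [Measure.restrict_univ]
    exact (aemeasurable_indicator_iff hΩ.measurableSet).2 (AEMeasurable.ereal_sub hw.1 hf.1)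
  · have h1 := ((hk.absContAlong_minimalGradient hp0).and hp0
      (hh.absContAlong_minimalGradient hp0)).and hp0
      ((hu.aeAlong_finite hp0 hΩ univ).and hp0 (hf.aeAlong_finite hp0 hΩ univ))
    refine h1.mono fun γ _ hγ => hγ.1.1.of_eq_coe_add hγ.1.2 fun t ht => ?_
    have hkt := hγ.1.1.coe_toReal ht
    have hht := hγ.1.2.coe_toReal ht
    by_cases htΩ : γ.toFun t ∈ Ω
    · rw [indicator_of_mem htΩ]
      have hut := hγ.2.1 t ht htΩ
      have hft := hγ.2.2 t ht htΩ
      have hut' := EReal.coe_toReal hut.1 hut.2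
      have hft' := EReal.coe_toReal hft.1 hft.2
      rw [hksub _ htΩ, ← hut', ← hft', ← EReal.coe_sub, EReal.toReal_coe]
      by_cases htV : γ.toFun t ∈ V
      · rw [piecewise_eq_of_mem _ _ _ htV]
        have h2 := hsub _ htV
        rw [← hut', ← hht] at h2
        rw [eq_coe_add_of_sub_eq_coe h2.symm, ← EReal.coe_sub]
        norm_cast
        ring
      · rw [piecewise_eq_of_notMem _ _ _ htV, hzero _ htV, ← hut', ← EReal.coe_sub]
        simp
    · rw [indicator_of_notMem htΩ, hkzero _ htΩ, hzero _ fun hx => htΩ (hVΩ hx)]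
      simp
  · exact ENNReal.lintegral_rpow_add_lt_top_of_lintegral_rpow_lt_top hkg.1
      (hk.energy_lt_top hp0) (hh.energy_lt_top hp0) hp

theorem IsObstacleSolution.restrict (hp : 1 ≤ p) (hμ : μ univ ≠ 0)
    (hu : IsObstacleSolution μ p Ω ψ f u) (hV : IsOpen V) (hne : V.Nonempty) (hVΩ : V ⊆ Ω) :
    IsObstacleSolution μ p V ψ u u := by
  classical
  have hp0 : 0 < p := by linarith
  obtain ⟨huD, huf, hcap⟩ := hu.mem
  have huV := huD.of_subset hVΩ
  have hsubset : {x ∈ V | ¬ ψ x ≤ u x} ⊆ {x ∈ Ω | ¬ ψ x ≤ u x} := fun x hx => ⟨hVΩ hx.1, hx.2⟩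
  refine ⟨hne, hV, hu.capacity_compl_pos.trans_le (capacity_mono (compl_subset_compl.2 hVΩ)), huV,
    ⟨huV, huV.memDirichletZero_sub_self hp hV,
      le_antisymm ((capacity_mono hsubset).trans hcap.le) bot_le⟩, ?_⟩
  rintro v ⟨hv, hvu, hvcap⟩
  have hmem : V.piecewise v u ∈ obstacleClass μ p Ω ψ f := by
    refine ⟨huD.piecewise hp hV hVΩ hv hvu,
      memDirichletZero_piecewise_sub hp hu.isOpen hV hVΩ huD hv hu.boundary_mem huf hvu, ?_⟩
    refine le_antisymm ((capacity_mono ?_).trans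
      (capacity_union_eq_zero hp hμ hvcap hcap).le) bot_le
    rintro x ⟨hxΩ, hx⟩
    by_cases hxV : x ∈ V
    · exact Or.inl ⟨hxV, by rwa [piecewise_eq_of_mem _ _ _ hxV] at hx⟩
    · exact Or.inr ⟨hxΩ, by rwa [piecewise_eq_of_notMem _ _ _ hxV] at hx⟩
  have hweak := isWeakUpperGradient_piecewise hp0 hV hVΩ huD hv hvu
  have hint := lintegral_piecewise_rpow (p := p) (μ := μ) hV.measurableSet hVΩ
    (minimalGradient μ p V v) (minimalGradient μ p Ω u)
  have hdiff : ∫⁻ x in Ω \ V, minimalGradient μ p Ω u x ^ p ∂μ < ∞ :=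
    (lintegral_mono_set sdiff_subset).trans_lt (huD.energy_lt_top hp0)
  have hle : energy μ p Ω u ≤
      energy μ p V v + ∫⁻ x in Ω \ V, minimalGradient μ p Ω u x ^ p ∂μ := by
    refine (hu.energy_le _ hmem).trans ((energy_le_lintegral hp0 hweak ?_).trans hint.le)
    rw [hint, ENNReal.add_lt_top]
    exact ⟨hv.energy_lt_top hp0, hdiff⟩
  have hsplit : energy μ p Ω u = ∫⁻ x in V, minimalGradient μ p Ω u x ^ p ∂μ +
      ∫⁻ x in Ω \ V, minimalGradient μ p Ω u x ^ p ∂μ := by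
    rw [energy, ← lintegral_inter_add_sdiff _ Ω hV.measurableSet,
      inter_eq_self_of_subset_right hVΩ]
  rw [hsplit] at hle
  -- The gradient of `u` on `Ω` is admissible on `V`, and the finite energy over `Ω \ V` cancels.
  refine le_trans (energy_le_lintegral hp0
    ((huD.minimalGradient_isWeakUpperGradient hp0).of_subset hVΩ hp0) ?_)
    (ENNReal.le_of_add_le_add_right hdiff.ne hle)
  exact (lintegral_mono_set hVΩ).trans_lt (huD.energy_lt_top hp0)

end MetricObstacle

namespace MetricObstacle

/-- The truncation of `a` at the levels `-k` and `k`. -/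
noncomputable def truncate (k : ℕ) (a : EReal) : ℝ :=
  (max ((-(k : ℝ) : ℝ) : EReal) (min a ((k : ℝ) : EReal))).toReal

theorem truncate_coe (k : ℕ) (a : ℝ) : truncate k a = max (-(k : ℝ)) (min a k) := by
  rw [truncate, ← EReal.coe_strictMono.monotone.map_min, ← EReal.coe_strictMono.monotone.map_max,
    EReal.toReal_coe]

theorem truncate_top (k : ℕ) : truncate k ⊤ = k := by
  rw [truncate, min_eq_right le_top, max_eq_right, EReal.toReal_coe]
  exact_mod_cast (neg_nonpos.2 k.cast_nonneg).trans (k.cast_nonneg (α := ℝ))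

theorem truncate_bot (k : ℕ) : truncate k ⊥ = -k := by
  rw [truncate, min_eq_left bot_le, max_eq_left bot_le, EReal.toReal_coe]

theorem measurable_truncate (k : ℕ) : Measurable (truncate k) :=
  measurable_ereal_toReal.comp (measurable_const.max (measurable_id.min measurable_const))

theorem ofReal_abs_truncate (k : ℕ) (a : EReal) :
    ENNReal.ofReal |truncate k a| = min a.abs k := by
  induction a with
  | bot => rw [truncate_bot]; simp
  | top => rw [truncate_top]; simp
  | coe a =>
    rw [truncate_coe, EReal.abs_def, ← ENNReal.ofReal_natCast,
      ← ENNReal.ofReal_mono.map_min]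
    congr 1
    have hk : (0 : ℝ) ≤ k := k.cast_nonneg
    rcases le_total a k with h1 | h1
    · rcases le_total (-(k : ℝ)) a with h2 | h2
      · rw [min_eq_left h1, max_eq_right h2, min_eq_left (abs_le.2 ⟨h2, h1⟩)]
      · rw [min_eq_left h1, max_eq_left h2, min_eq_right (le_abs.2 (Or.inr (by linarith))),
          abs_neg, abs_of_nonneg hk]
    · rw [min_eq_right h1, max_eq_right (by linarith), abs_of_nonneg hk,
        min_eq_right (h1.trans (le_abs_self a))]

theorem abs_truncate_le (k : ℕ) (a : EReal) : |truncate k a| ≤ k := by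
  have h := ofReal_abs_truncate k a
  rw [← ENNReal.ofReal_le_ofReal_iff k.cast_nonneg, h, ENNReal.ofReal_natCast]
  exact min_le_right _ _

theorem abs_truncate_sub_le (k : ℕ) (a b : EReal) :
    ENNReal.ofReal |truncate k a - truncate k b| ≤ (a - b).abs := by
  by_cases h : (a - b).abs < ∞
  · obtain ⟨ha, hb⟩ := isFinite_of_abs_sub_lt_top h
    rw [← EReal.coe_toReal ha.1 ha.2, ← EReal.coe_toReal hb.1 hb.2, truncate_coe, truncate_coe,
      abs_coe_sub_coe]
    refine ENNReal.ofReal_le_ofReal ((abs_max_sub_max_le_max _ _ _ _).trans ?_)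
    rw [sub_self, abs_zero]
    refine max_le (abs_nonneg _) ((abs_min_sub_min_le_max _ _ _ _).trans ?_)
    rw [sub_self, abs_zero]
    exact max_le le_rfl (abs_nonneg _)
  · rw [not_lt_top_iff.1 h]
    exact le_top

theorem measurable_ereal_abs : Measurable EReal.abs :=
  EReal.measurable_of_measurable_real (ENNReal.measurable_ofReal.comp measurable_norm)

/-! ### Local integrability of Dirichlet functions from the Poincaré inequality. -/

variable {X : Type*} [MetricSpace X]

theorem UpperGradientIneq.of_integral_eq_top {g : X → ℝ≥0∞} {f : X → EReal} {γ : Curve X}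
    (h : γ.integral g = ∞) : UpperGradientIneq g f γ := by
  rw [UpperGradientIneq, h]
  exact le_top

-- A curve that leaves the closed set `K` spends positive length in its open complement.
open Classical in
theorem Curve.integral_piecewise_top (γ : Curve X) {K : Set X} (hK : IsClosed K)
    (g : X → ℝ≥0∞) (h : ¬ γ.InSet K) : γ.integral (K.piecewise g fun _ => ∞) = ∞ := by
  simp only [Curve.InSet, not_forall] at h
  obtain ⟨t, ht, htK⟩ := h
  obtain ⟨a, b, ha, hab, hb, -, -, hs⟩ := γ.exists_sub_of_mem_open hK.isOpen_compl ht htK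
  refine top_le_iff.1 ?_
  calc (∞ : ℝ≥0∞) = ∫⁻ _ in Icc a b, ∞ := by
        rw [setLIntegral_const, Real.volume_Icc, ENNReal.top_mul]
        simpa using hab
    _ = ∫⁻ t in Icc a b, K.piecewise g (fun _ => ∞) (γ.toFun t) :=
        setLIntegral_congr_fun measurableSet_Icc fun s hs' =>
          (piecewise_eq_of_notMem K g (fun _ => ∞) (hs s hs')).symm
    _ ≤ _ := lintegral_mono_set (Icc_subset_Icc ha hb)

open Classical in
theorem Curve.integral_piecewise_of_inSet (γ : Curve X) {K : Set X} (g k : X → ℝ≥0∞)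
    (h : γ.InSet K) : γ.integral (K.piecewise g k) = γ.integral g :=
  setLIntegral_congr_fun measurableSet_Icc fun t ht => piecewise_eq_of_mem K _ _ (h t ht)

variable [MeasurableSpace X]

/-- The point with infinite value is an end point of a subcurve, where the left-hand side of the
upper gradient inequality is infinite. -/
theorem IsUpperGradient.integral_eq_top {E : Set X} {g : X → ℝ≥0∞} {u : X → EReal}
    (h : IsUpperGradient E g u) {γ : Curve X} (hγ : γ.InSet E) {t : ℝ}
    (ht : t ∈ Icc 0 γ.length) (hu : (u (γ.toFun t)).abs = ∞) : γ.integral g = ∞ := by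
  have hinf : u (γ.toFun t) = ⊤ ∨ u (γ.toFun t) = ⊥ := by
    generalize u (γ.toFun t) = a at hu
    induction a with
    | bot => exact Or.inr rfl
    | top => exact Or.inl rfl
    | coe a => exact absurd hu (EReal.abs_coe_lt_top a).ne
  have key : ∀ σ : Curve X, σ.IsSub γ →
      (σ.toFun 0 = γ.toFun t ∨ σ.toFun σ.length = γ.toFun t) → γ.integral g = ∞ := by
    intro σ hσ hend
    by_contra hne
    have hlt := ((h.2 σ (hσ.inSet hγ)).trans (hσ.integral_le g)).trans_lt (lt_top_iff_ne_top.2 hne)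
    obtain ⟨h1, h2⟩ := isFinite_of_abs_sub_lt_top hlt
    rcases hend with he | he
    · rw [he] at h1
      exact hinf.elim h1.1 h1.2
    · rw [he] at h2
      exact hinf.elim h2.1 h2.2
  rcases ht.1.eq_or_lt with rfl | h0
  · exact key γ γ.isSub_refl (Or.inl rfl)
  · obtain ⟨σ, hσl, hσ⟩ := γ.exists_sub le_rfl h0 ht.2
    exact key σ ⟨0, le_rfl, by rw [hσl]; linarith [ht.2], hσ⟩
      (Or.inr (by rw [hσ, hσl]; congr 1; ring))

variable {μ : Measure X} {p : ℝ}

theorem measure_pos_of_isOpen (hμ : ∀ (x : X) (r : ℝ), 0 < r → 0 < μ (ball x r)) {U : Set X}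
    (hU : IsOpen U) (hne : U.Nonempty) : 0 < μ U := by
  obtain ⟨x, hx⟩ := hne
  obtain ⟨r, hr, hb⟩ := Metric.isOpen_iff.1 hU x hx
  exact (hμ x r hr).trans_le (measure_mono hb)

theorem measure_closedBall_lt_top (hμ : ∀ (x : X) (r : ℝ), 0 < r → μ (ball x r) < ∞) (x : X)
    (r : ℝ) : μ (closedBall x r) < ∞ :=
  (measure_mono (closedBall_subset_ball (lt_of_le_of_lt (le_abs_self r) (lt_add_one |r|)))).trans_lt
    (hμ x _ (by positivity))

/-- A Poincaré inequality on each ball, with a constant that may depend on the ball. -/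
def LocalPoincare (μ : Measure X) (p L : ℝ) : Prop :=
  1 ≤ L ∧ ∀ (x : X) (r : ℝ), 0 < r → ∃ M : ℝ≥0∞, M < ∞ ∧ ∀ w : X → ℝ, Integrable w μ →
    ∀ g : X → ℝ≥0∞, IsUpperGradient univ g (fun y => (w y : EReal)) →
      ∫⁻ y in ball x r, ENNReal.ofReal |w y - ⨍ z in ball x r, w z ∂μ| ^ p ∂μ ≤
        M * ∫⁻ y in ball x (L * r), g y ^ p ∂μ

theorem SupportsPoincare.localPoincare
    (hμ : ∀ (x : X) (r : ℝ), 0 < r → 0 < μ (ball x r) ∧ μ (ball x r) < ∞) (hp : 0 < p)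
    (h : SupportsPoincare μ p p) : ∃ L, LocalPoincare μ p L := by
  obtain ⟨C, -, L, hL, H⟩ := h
  refine ⟨L, hL, fun x r hr => ?_⟩
  have hLr : 0 < L * r := by positivity
  set c := ENNReal.ofReal (C * diam (ball x r))
  refine ⟨c ^ p * (μ (ball x (L * r)))⁻¹ * μ (ball x r), ?_, fun w hw g hg => ?_⟩
  · exact ENNReal.mul_lt_top (ENNReal.mul_lt_top (ENNReal.rpow_lt_top_of_nonneg hp.le (by simp [c]))
      (by simpa using (hμ x _ hLr).1)) (hμ x r hr).2
  · have h1 := ENNReal.rpow_le_rpow (H x r hr w hw g hg) hp.le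
    rw [ENNReal.mul_rpow_of_nonneg _ _ hp.le, one_div, ENNReal.rpow_inv_rpow hp.ne',
      ENNReal.rpow_inv_rpow hp.ne', setLAverage_eq, setLAverage_eq,
      ENNReal.div_le_iff (hμ x r hr).1.ne' (hμ x r hr).2.ne] at h1
    refine h1.trans (le_of_eq ?_)
    rw [ENNReal.div_eq_inv_mul]
    ring

variable [BorelSpace X]

-- Truncation is 1-Lipschitz, and the value `∞` off `K` pays for the jump to zero at the boundary of
-- `K`. This yields functions on all of `X`, as the Poincaré inequality demands.
open Classical in
theorem IsUpperGradient.truncate {Ω K : Set X} {g : X → ℝ≥0∞} {u : X → EReal}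
    (h : IsUpperGradient Ω g u) (hK : IsClosed K) (hKΩ : K ⊆ Ω) (k : ℕ) :
    IsUpperGradient univ (K.piecewise g fun _ => ∞)
      (fun x => ((K.indicator (fun x => MetricObstacle.truncate k (u x)) x : ℝ) : EReal)) := by
  refine ⟨h.1.piecewise hK.measurableSet measurable_const, fun γ _ => ?_⟩
  by_cases hγ : γ.InSet K
  · rw [UpperGradientIneq, γ.integral_piecewise_of_inSet _ _ hγ,
      indicator_of_mem (hγ 0 ⟨le_rfl, γ.length_pos.le⟩),
      indicator_of_mem (hγ _ ⟨γ.length_pos.le, le_rfl⟩), abs_coe_sub_coe]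
    exact (abs_truncate_sub_le k _ _).trans (h.2 γ (hγ.mono hKΩ))
  · exact .of_integral_eq_top (γ.integral_piecewise_top hK g hγ)

/-- If all multiples of the characteristic function of `D` have a common upper gradient of finite
energy, then `D` or its complement is null in the ball. -/
theorem LocalPoincare.measure_eq_zero_or {L : ℝ} (h : LocalPoincare μ p L) (hp : 0 < p) {x : X}
    {r : ℝ} (hr : 0 < r) {D : Set X} (hD : MeasurableSet D) (hDfin : μ D < ∞) {g : X → ℝ≥0∞}
    (hg : ∀ n : ℕ, IsUpperGradient univ g
      (fun y => ((n * D.indicator (fun _ => (1 : ℝ)) y : ℝ) : EReal)))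
    (hfin : ∫⁻ y in ball x (L * r), g y ^ p ∂μ < ∞) :
    μ (ball x r ∩ D) = 0 ∨ μ (ball x r \ D) = 0 := by
  obtain ⟨M, hM, H⟩ := h.2 x r hr
  set w : X → ℝ := D.indicator fun _ => (1 : ℝ)
  have hw : Integrable w μ := (integrable_indicator_iff hD).2 (integrableOn_const hDfin.ne)
  set c := ⨍ z in ball x r, w z ∂μ
  -- The left side scales like `n ^ p` while the right side is fixed, so the oscillation of the
  -- characteristic function is zero.
  have hbound : ∀ n : ℕ, (n : ℝ≥0∞) ^ p * ∫⁻ y in ball x r, ENNReal.ofReal |w y - c| ^ p ∂μ ≤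
      M * ∫⁻ y in ball x (L * r), g y ^ p ∂μ := by
    intro n
    refine le_trans (le_of_eq ?_) (H (fun y => n * w y) (hw.const_mul _) g (hg n))
    rw [← lintegral_const_mul' _ _ (ENNReal.rpow_ne_top_of_nonneg hp.le (by simp))]
    refine lintegral_congr fun y => ?_
    rw [← ENNReal.mul_rpow_of_nonneg _ _ hp.le, setAverage_eq, integral_const_mul,
      smul_eq_mul, mul_left_comm, ← smul_eq_mul (μ.real (ball x r))⁻¹, ← setAverage_eq,
      ← mul_sub, abs_mul, ENNReal.ofReal_mul (abs_nonneg _), Nat.abs_cast, ENNReal.ofReal_natCast]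
  have hzero : ∫⁻ y in ball x r, ENNReal.ofReal |w y - c| ^ p ∂μ = 0 := by
    by_contra hne
    have htop : Filter.Tendsto (fun n : ℕ => (n : ℝ≥0∞) ^ p *
        ∫⁻ y in ball x r, ENNReal.ofReal |w y - c| ^ p ∂μ) Filter.atTop (nhds ∞) := by
      have h1 : Filter.Tendsto (fun n : ℕ => (n : ℝ≥0∞) ^ p) Filter.atTop (nhds ∞) := by
        have := (ENNReal.continuous_rpow_const (y := p)).continuousAt.tendsto.comp
          ENNReal.tendsto_nat_nhds_top
        rwa [ENNReal.top_rpow_of_pos hp] at this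
      have h2 := ENNReal.Tendsto.mul_const (b := ∫⁻ y in ball x r, ENNReal.ofReal |w y - c| ^ p ∂μ)
        h1 (Or.inl ENNReal.top_ne_zero)
      rwa [ENNReal.top_mul hne] at h2
    exact absurd (le_of_tendsto' htop hbound) (not_le.2 (ENNReal.mul_lt_top hM hfin))
  have hwm : Measurable w := measurable_const.indicator hD
  have hae : ∀ᵐ y ∂μ.restrict (ball x r), w y = c := by
    rw [lintegral_eq_zero_iff (by fun_prop)] at hzero
    filter_upwards [hzero] with y hy
    have := (ENNReal.rpow_eq_zero_iff_of_pos hp).1 hy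
    rw [ENNReal.ofReal_eq_zero] at this
    exact sub_eq_zero.1 (abs_eq_zero.1 (le_antisymm this (abs_nonneg _)))
  rw [ae_restrict_iff' measurableSet_ball] at hae
  by_cases hc : c = 0
  · refine Or.inl (measure_mono_null ?_ hae)
    rintro y ⟨hy, hyD⟩ hcon
    have := hcon hy
    simp [w, hyD, hc] at this
  · refine Or.inr (measure_mono_null ?_ hae)
    rintro y ⟨hy, hyD⟩ hcon
    have := hcon hy
    simp only [w, indicator_of_notMem hyD] at this
    exact hc this.symm

/-- A space with at least two points that supports a Poincaré inequality has no isolated points. -/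
theorem LocalPoincare.exists_ne_mem_ball {L : ℝ} (h : LocalPoincare μ p L) (hp : 0 < p)
    (hμ : ∀ (x : X) (r : ℝ), 0 < r → 0 < μ (ball x r) ∧ μ (ball x r) < ∞) {x y : X}
    (hxy : y ≠ x) {r : ℝ} (hr : 0 < r) : ∃ z ∈ ball x r, z ≠ x := by
  by_contra hcon
  push Not at hcon
  have hball : ball x r = {x} :=
    subset_antisymm (fun z hz => hcon z hz) (singleton_subset_iff.2 (mem_ball_self hr))
  have hclopen : IsClopen ({x} : Set X) := ⟨isClosed_singleton, hball ▸ isOpen_ball⟩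
  have hR : 0 < dist y x + 1 := by positivity
  -- Curves are connected and `{x}` would be clopen, so its characteristic function is constant
  -- along each of them.
  have hzero : ∀ n : ℕ, IsUpperGradient univ (fun _ => 0)
      (fun y => ((n * ({x} : Set X).indicator (fun _ => (1 : ℝ)) y : ℝ) : EReal)) := by
    refine fun n => ⟨measurable_const, fun γ _ => ?_⟩
    have hpre : IsPreconnected (γ.toFun '' Icc 0 γ.length) :=
      isPreconnected_Icc.image _ γ.continuousOn
    have h0 : γ.toFun 0 ∈ γ.toFun '' Icc 0 γ.length := ⟨0, ⟨le_rfl, γ.length_pos.le⟩, rfl⟩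
    have h1 : γ.toFun γ.length ∈ γ.toFun '' Icc 0 γ.length :=
      ⟨_, ⟨γ.length_pos.le, le_rfl⟩, rfl⟩
    have heq : ({x} : Set X).indicator (fun _ => (1 : ℝ)) (γ.toFun 0) =
        ({x} : Set X).indicator (fun _ => (1 : ℝ)) (γ.toFun γ.length) := by
      by_cases hx : x ∈ γ.toFun '' Icc 0 γ.length
      · have hsub := hpre.subset_isClopen hclopen ⟨x, hx, rfl⟩
        rw [indicator_of_mem (hsub h0), indicator_of_mem (hsub h1)]
      · rw [indicator_of_notMem, indicator_of_notMem]
        · rintro rfl; exact hx h1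
        · rintro rfl; exact hx h0
    rw [UpperGradientIneq, abs_coe_sub_coe, heq]
    simp
  have hpos : ∀ {U : Set X}, IsOpen U → U.Nonempty → μ U ≠ 0 := fun hU hne =>
    (measure_pos_of_isOpen (fun x r hr => (hμ x r hr).1) hU hne).ne'
  rcases h.measure_eq_zero_or hp hR (measurableSet_singleton x) (hball ▸ (hμ x r hr).2) hzero
    (by simp [hp]) with h1 | h1
  · exact hpos (isOpen_ball.inter hclopen.2) ⟨x, mem_ball_self hR, rfl⟩ h1
  · exact hpos (isOpen_ball.sdiff hclopen.1) ⟨y, by simp, hxy⟩ h1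

-- If `u` were infinite a.e. in the ball, a curve in `K` would either meet a point with `u`
-- infinite, where `g` has infinite integral, or stay in a null set, where the value `∞` can be
-- added for free. Every function would then have the same upper gradient of finite energy in a
-- smaller ball. The second point `y` is essential: in a one-point space `u = ∞` has upper gradient
-- zero.
open Classical in
theorem exists_measure_abs_le_ne_zero {L : ℝ} (hPI : LocalPoincare μ p L) (hp : 0 < p)
    (hμ : ∀ (x : X) (r : ℝ), 0 < r → 0 < μ (ball x r) ∧ μ (ball x r) < ∞) {Ω : Set X}
    {g : X → ℝ≥0∞} {u : X → EReal} (hg : IsUpperGradient Ω g u)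
    (hfin : ∫⁻ y in Ω, g y ^ p ∂μ < ∞) {x y : X} (hxy : y ≠ x) {r : ℝ} (hr : 0 < r)
    (hΩ : ball x r ⊆ Ω) : ∃ m : ℕ, μ {z ∈ ball x r | (u z).abs ≤ m} ≠ 0 := by
  by_contra hcon
  push Not at hcon
  have hL : 0 < L := by linarith [hPI.1]
  set N : Set X := ⋃ m : ℕ, {z ∈ ball x r | (u z).abs ≤ m}
  have hN : μ N = 0 := measure_iUnion_null hcon
  set N' := toMeasurable μ N
  have hN' : μ N' = 0 := by rw [measure_toMeasurable, hN]
  have hN'm : MeasurableSet N' := measurableSet_toMeasurable _ _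
  set s := r / (2 * L)
  have hs : 0 < s := by positivity
  have hLs : L * s = r / 2 := by simp only [s]; field_simp
  set K := closedBall x (L * s)
  have hKr : K ⊆ ball x r := closedBall_subset_ball (by rw [hLs]; linarith)
  set k : X → ℝ≥0∞ := fun z => g z + N'.indicator (fun _ => ∞) z
  have hk : Measurable k := hg.1.add (measurable_const.indicator hN'm)
  have hinf : ∀ γ : Curve X, γ.integral (K.piecewise k fun _ => ∞) = ∞ := by
    intro γ
    by_cases hγ : γ.InSet K
    · rw [γ.integral_piecewise_of_inSet _ _ hγ]
      by_cases hex : ∃ t ∈ Icc 0 γ.length, (u (γ.toFun t)).abs = ∞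
      · obtain ⟨t, ht, hut⟩ := hex
        refine top_le_iff.1 ?_
        rw [← hg.integral_eq_top (hγ.mono (hKr.trans hΩ)) ht hut]
        exact γ.integral_mono fun z => le_self_add
      · push Not at hex
        refine top_le_iff.1 ?_
        calc (∞ : ℝ≥0∞) = ∫⁻ _ in Icc 0 γ.length, ∞ := by
              rw [setLIntegral_const, Real.volume_Icc, ENNReal.top_mul]
              simpa using γ.length_pos
          _ = ∫⁻ t in Icc 0 γ.length, N'.indicator (fun _ => ∞) (γ.toFun t) := by
              refine setLIntegral_congr_fun measurableSet_Icc fun t ht => ?_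
              have hmem : γ.toFun t ∈ N' := by
                refine subset_toMeasurable _ _ ?_
                obtain ⟨m, hm⟩ := ENNReal.exists_nat_gt (hex t ht)
                exact mem_iUnion.2 ⟨m, hKr (hγ t ht), hm.le⟩
              simp only [indicator_of_mem hmem]
          _ ≤ γ.integral k := γ.integral_mono fun z => le_add_self
    · exact γ.integral_piecewise_top isClosed_closedBall k hγ
  have hKfin : ∫⁻ y in ball x (L * s), K.piecewise k (fun _ => ∞) y ^ p ∂μ < ∞ := by
    have hsub : ball x (L * s) ⊆ Ω := (ball_subset_closedBall.trans hKr).trans hΩ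
    refine lt_of_le_of_lt (le_of_eq ?_) ((lintegral_mono_set hsub).trans_lt hfin)
    refine lintegral_congr_ae ?_
    filter_upwards [ae_restrict_mem measurableSet_ball,
      ae_restrict_of_ae (measure_eq_zero_iff_ae_notMem.1 hN')] with z hz hzN
    rw [piecewise_eq_of_mem _ _ _ (ball_subset_closedBall hz)]
    simp only [k, indicator_of_notMem hzN, add_zero]
  -- A small ball around `x` and the exterior of its closure both meet the larger ball in nonempty
  -- open sets, hence in positive measure.
  obtain ⟨z, hz, hzx⟩ := hPI.exists_ne_mem_ball hp hμ hxy hs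
  have hd : 0 < dist z x := dist_pos.2 hzx
  have hpos : ∀ {U : Set X}, IsOpen U → U.Nonempty → μ U ≠ 0 := fun hU hne =>
    (measure_pos_of_isOpen (fun x r hr => (hμ x r hr).1) hU hne).ne'
  rcases hPI.measure_eq_zero_or hp hs (D := ball x (dist z x / 2))
    (g := K.piecewise k fun _ => ∞) measurableSet_ball (hμ x _ (by positivity)).2
    (fun n => ⟨hk.piecewise isClosed_closedBall.measurableSet measurable_const,
      fun γ _ => .of_integral_eq_top (hinf γ)⟩) hKfin with h1 | h1
  · exact hpos (isOpen_ball.inter isOpen_ball)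
      ⟨x, mem_ball_self hs, mem_ball_self (by positivity)⟩ h1
  · refine hpos (isOpen_ball.inter (isClosed_closedBall (x := x)
      (ε := dist z x / 2)).isOpen_compl) ⟨z, hz, ?_⟩ (measure_mono_null ?_ h1)
    · simp only [mem_compl_iff, mem_closedBall, not_le]; linarith
    · exact fun w hw => ⟨hw.1, fun hw' => hw.2 (ball_subset_closedBall hw')⟩

open Classical in
theorem exists_ball_lintegral_abs_lt_top {L : ℝ} (hPI : LocalPoincare μ p L) (hp : 1 ≤ p)
    (hμ : ∀ (x : X) (r : ℝ), 0 < r → 0 < μ (ball x r) ∧ μ (ball x r) < ∞) {Ω : Set X}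
    (hΩ : IsOpen Ω) {u : X → EReal} (hu : MemDirichlet μ p Ω u) {x y : X} (hxy : y ≠ x)
    (hx : x ∈ Ω) : ∃ r, 0 < r ∧ ∫⁻ z in ball x r, (u z).abs ^ p ∂μ < ∞ := by
  have hp0 : 0 < p := by linarith
  have hL : 0 < L := by linarith [hPI.1]
  obtain ⟨hum, g, hg, hgfin⟩ := hu
  obtain ⟨R, hR, hRΩ⟩ := Metric.nhds_basis_closedBall.mem_iff.1 (hΩ.mem_nhds hx)
  -- The dilated ball of the Poincaré inequality is then the ball of radius `R`, on which the
  -- truncations keep the upper gradient `g`.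
  set r := R / L
  have hr : 0 < r := by positivity
  have hLr : L * r = R := by simp only [r]; field_simp
  set K := closedBall x R
  have hBK : ball x r ⊆ K := by
    refine ball_subset_closedBall.trans (closedBall_subset_closedBall ?_)
    rw [← hLr]
    exact le_mul_of_one_le_left hr.le hPI.1
  obtain ⟨m, hm⟩ := exists_measure_abs_le_ne_zero hPI hp0 hμ hg hgfin hxy hr (hBK.trans hRΩ)
  obtain ⟨M, hM, H⟩ := hPI.2 x r hr
  set A := M * ∫⁻ z in Ω, g z ^ p ∂μ
  have hA : A < ∞ := ENNReal.mul_lt_top hM hgfin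
  set w : ℕ → X → ℝ := fun k => K.indicator fun z => truncate k (u z)
  set c : ℕ → ℝ := fun k => ⨍ z in ball x r, w k z ∂μ
  have hwm : ∀ k, AEMeasurable (w k) μ := fun k =>
    (aemeasurable_indicator_iff isClosed_closedBall.measurableSet).2
      ((measurable_truncate k).comp_aemeasurable
        (hum.mono_measure (Measure.restrict_mono hRΩ le_rfl)))
  have hwint : ∀ k, Integrable (w k) μ := fun k => by
    rw [integrable_indicator_iff isClosed_closedBall.measurableSet]
    refine ⟨?_, .restrict_of_bounded (C := k)
      (measure_closedBall_lt_top (fun x r hr => (hμ x r hr).2) x R) ?_⟩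
    · exact ((measurable_truncate k).comp_aemeasurable
        (hum.mono_measure (Measure.restrict_mono hRΩ le_rfl))).aestronglyMeasurable
    · exact Filter.Eventually.of_forall fun z => abs_truncate_le k _
  have hosc : ∀ k, ∫⁻ z in ball x r, ENNReal.ofReal |w k z - c k| ^ p ∂μ ≤ A := by
    intro k
    refine (H (w k) (hwint k) _ (hg.truncate isClosed_closedBall hRΩ k)).trans ?_
    refine mul_le_mul_right (le_trans (le_of_eq ?_)
      (lintegral_mono_set (ball_subset_closedBall.trans hRΩ))) M
    rw [hLr]
    refine setLIntegral_congr_fun measurableSet_ball fun z hz => ?_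
    simp only [piecewise_eq_of_mem _ _ _ (ball_subset_closedBall hz)]
  have hval : ∀ k, ∀ z ∈ ball x r, ENNReal.ofReal |w k z| = min (u z).abs k := fun k z hz => by
    simp only [w, indicator_of_mem (hBK hz), ofReal_abs_truncate]
  set S := {z ∈ ball x r | (u z).abs ≤ m}
  have hSB : S ⊆ ball x r := fun z hz => hz.1
  have hS : μ S ≠ ∞ := ((measure_mono hSB).trans_lt (hμ x r hr).2).ne
  set q : ℝ≥0∞ := 2 ^ (p - 1)
  have hq : q < ∞ := ENNReal.rpow_lt_top_of_nonneg (by linarith) (by simp)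
  set T := q * (A + (m : ℝ≥0∞) ^ p * μ S) / μ S
  have hT : T < ∞ := by
    refine ENNReal.div_lt_top (ENNReal.mul_lt_top hq (ENNReal.add_lt_top.2 ⟨hA, ?_⟩)).ne hm
    exact ENNReal.mul_lt_top (ENNReal.rpow_lt_top_of_nonneg hp0.le (by simp))
      (lt_top_iff_ne_top.2 hS)
  have hom : ∀ k, AEMeasurable (fun z => ENNReal.ofReal |w k z - c k| ^ p) μ := fun k =>
    (ENNReal.measurable_ofReal.comp_aemeasurable
      (measurable_norm.comp_aemeasurable ((hwm k).sub_const _))).pow_const p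
  -- Integrating `|c k| ≤ |w k - c k| + |w k|` over `S`, where `|w k| ≤ m`, bounds the means
  -- independently of `k`.
  have hc : ∀ k, ENNReal.ofReal |c k| ^ p ≤ T := by
    intro k
    rw [ENNReal.le_div_iff_mul_le (Or.inl hm) (Or.inl hS), ← setLIntegral_const]
    calc ∫⁻ _ in S, ENNReal.ofReal |c k| ^ p ∂μ
        ≤ ∫⁻ z in S, q * (ENNReal.ofReal |w k z - c k| ^ p + (m : ℝ≥0∞) ^ p) ∂μ := by
          refine setLIntegral_mono_ae (((hom k).restrict.add_const _).const_mul _)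
            (Filter.Eventually.of_forall fun z hz => ?_)
          refine le_trans (ENNReal.rpow_le_rpow ?_ hp0.le)
            (ENNReal.rpow_add_le_mul_rpow_add_rpow _ _ hp)
          have h1 : |c k| ≤ |w k z - c k| + |w k z| := by
            rw [abs_sub_comm]
            simpa using abs_add_le (c k - w k z) (w k z)
          refine (ENNReal.ofReal_le_ofReal h1).trans (ENNReal.ofReal_add_le.trans ?_)
          rw [hval k z hz.1]
          exact add_le_add le_rfl ((min_le_left _ _).trans hz.2)
      _ = q * (∫⁻ z in S, ENNReal.ofReal |w k z - c k| ^ p ∂μ + (m : ℝ≥0∞) ^ p * μ S) := by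
          rw [lintegral_const_mul' _ _ hq.ne, lintegral_add_right _ measurable_const,
            setLIntegral_const]
      _ ≤ q * (A + (m : ℝ≥0∞) ^ p * μ S) := by
          gcongr
          exact (lintegral_mono_set hSB).trans (hosc k)
  have hw : ∀ k, ∫⁻ z in ball x r, ENNReal.ofReal |w k z| ^ p ∂μ ≤ q * (A + T * μ (ball x r)) := by
    intro k
    calc ∫⁻ z in ball x r, ENNReal.ofReal |w k z| ^ p ∂μ
        ≤ ∫⁻ z in ball x r, q * (ENNReal.ofReal |w k z - c k| ^ p + T) ∂μ := by
          refine lintegral_mono fun z => ?_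
          have h1 : |w k z| ≤ |w k z - c k| + |c k| := by
            simpa using abs_add_le (w k z - c k) (c k)
          refine (ENNReal.rpow_le_rpow ((ENNReal.ofReal_le_ofReal h1).trans ENNReal.ofReal_add_le)
            hp0.le).trans ((ENNReal.rpow_add_le_mul_rpow_add_rpow _ _ hp).trans ?_)
          exact mul_le_mul_right (add_le_add le_rfl (hc k)) q
      _ = q * (∫⁻ z in ball x r, ENNReal.ofReal |w k z - c k| ^ p ∂μ + T * μ (ball x r)) := by
          rw [lintegral_const_mul' _ _ hq.ne, lintegral_add_right _ measurable_const,
            setLIntegral_const]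
      _ ≤ _ := by gcongr; exact hosc k
  refine ⟨r, hr, ?_⟩
  -- The truncations recover `|u|` in the limit, including infinite values, so Fatou's lemma
  -- transfers the uniform bound.
  have hlim : ∀ z ∈ ball x r, (u z).abs ^ p =
      Filter.liminf (fun k => ENNReal.ofReal |w k z| ^ p) Filter.atTop := by
    intro z hz
    refine (Filter.Tendsto.liminf_eq ?_).symm
    have h1 : Filter.Tendsto (fun k : ℕ => min (u z).abs (k : ℝ≥0∞)) Filter.atTop
        (nhds (min (u z).abs ∞)) := tendsto_const_nhds.min ENNReal.tendsto_nat_nhds_top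
    rw [min_eq_left le_top] at h1
    simp only [hval _ z hz]
    exact (ENNReal.continuous_rpow_const (y := p)).continuousAt.tendsto.comp h1
  rw [setLIntegral_congr_fun measurableSet_ball hlim]
  refine (lintegral_liminf_le' fun k => ?_).trans_lt (lt_of_le_of_lt
    (Filter.liminf_le_of_frequently_le' (Filter.Frequently.of_forall hw)) ?_)
  · exact ((ENNReal.measurable_ofReal.comp_aemeasurable
      (measurable_norm.comp_aemeasurable (hwm k))).pow_const p).restrict
  · exact ENNReal.mul_lt_top hq (ENNReal.add_lt_top.2 ⟨hA, ENNReal.mul_lt_top hT (hμ x r hr).2⟩)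

theorem MemDirichlet.lintegral_abs_lt_top_of_isCompact {L : ℝ} (hPI : LocalPoincare μ p L)
    (hp : 1 ≤ p) (hμ : ∀ (x : X) (r : ℝ), 0 < r → 0 < μ (ball x r) ∧ μ (ball x r) < ∞)
    {Ω : Set X} (hΩ : IsOpen Ω) {u : X → EReal} (hu : MemDirichlet μ p Ω u)
    (hne : Ωᶜ.Nonempty) {K : Set X} (hK : IsCompact K) (hKΩ : K ⊆ Ω) :
    ∫⁻ z in K, (u z).abs ^ p ∂μ < ∞ := by
  obtain ⟨y, hy⟩ := hne
  refine hK.induction_on (p := fun s => ∫⁻ z in s, (u z).abs ^ p ∂μ < ∞) (by simp)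
    (fun s t hst ht => (lintegral_mono_set hst).trans_lt ht)
    (fun s t hs ht => (lintegral_union_le _ _ _).trans_lt (ENNReal.add_lt_top.2 ⟨hs, ht⟩))
    fun x hx => ?_
  obtain ⟨r, hr, h⟩ := exists_ball_lintegral_abs_lt_top hPI hp hμ hΩ hu (x := x) (y := y)
    (by rintro rfl; exact hy (hKΩ hx)) (hKΩ hx)
  exact ⟨ball x r, mem_nhdsWithin_of_mem_nhds (ball_mem_nhds x hr), h⟩

theorem IsObstacleSolution.isBounded [SecondCountableTopology X] (hp : 1 ≤ p) {V : Set X}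
    {ψ u : X → EReal} (hu : IsObstacleSolution μ p V ψ u u) (hV : Bornology.IsBounded V)
    (hμ : μ V ≠ 0) (hfin : ∫⁻ x in V, (u x).abs ^ p ∂μ < ∞) :
    IsBoundedObstacleSolution μ p V ψ u u := by
  have hp0 : 0 < p := by linarith
  have hμ' : μ univ ≠ 0 := fun h => hμ (measure_mono_null (subset_univ V) h)
  have huN : MemNewtonian μ p V u := (memNewtonian_iff hp hμ).2 ⟨hu.boundary_mem, hfin⟩
  have hD := hu.boundary_mem.indicator_sub_self hp hu.isOpen
  -- Integrability of `|u| ^ p` makes `u` finite a.e. in `V`, so `u - u` vanishes a.e. although it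
  -- need not vanish everywhere.
  have hae : ∀ᵐ x ∂μ, (V.indicator (fun x => u x - u x) x).abs ^ p = 0 := by
    have h1 := ae_lt_top' ((measurable_ereal_abs.comp_aemeasurable
      hu.boundary_mem.1).pow_const p) hfin.ne
    rw [ae_restrict_iff' hu.isOpen.measurableSet] at h1
    filter_upwards [h1] with x hx
    by_cases hxV : x ∈ V
    · have h2 := hx hxV
      rw [indicator_of_mem hxV]
      have h3 : (u x).abs ≠ ∞ := fun h => by simp [h, hp0] at h2
      rw [EReal.sub_self]
      · simp [hp0]
      · intro h; simp [h] at h3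
      · intro h; simp [h] at h3
    · rw [indicator_of_notMem hxV]
      simp [hp0]
  refine ⟨hu.nonempty, hV, hu.isOpen, hu.capacity_compl_pos, huN,
    ⟨huN, ⟨_, (memNewtonian_iff hp hμ').2 ⟨hD, ?_⟩, fun _ hx => indicator_of_notMem hx _,
      fun _ hx => indicator_of_mem hx _⟩, hu.mem.2.2⟩, ?_⟩
  · rw [Measure.restrict_univ, lintegral_congr_ae hae]
    simp
  -- The bounded class lies in the Dirichlet class, so minimality is inherited.
  · rintro v ⟨hv, ⟨h, hh, h0, hsub⟩, hcap⟩
    exact hu.energy_le v ⟨((memNewtonian_iff hp hμ).1 hv).1,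
      ⟨h, ((memNewtonian_iff hp hμ').1 hh).1, h0, hsub⟩, hcap⟩

end MetricObstacle

theorem proposition3p7 {X : Type*} [MetricSpace X] [ProperSpace X]
    [MeasurableSpace X] [BorelSpace X] (μ : MeasureTheory.Measure X)
    (hμ : ∀ (x : X) (r : ℝ), 0 < r → 0 < μ (Metric.ball x r) ∧ μ (Metric.ball x r) < ⊤)
    (p : ℝ) (hp : 1 < p) (hPI : MetricObstacle.SupportsPoincare μ p p)
    (Ω : Set X) (ψ f u : X → EReal)
    (hu : MetricObstacle.IsObstacleSolution μ p Ω ψ f u)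
    (Ω' : Set X) (hΩ'_open : IsOpen Ω') (hΩ'_ne : Ω'.Nonempty) (hΩ' : Ω' ⊆ Ω) :
    MetricObstacle.IsObstacleSolution μ p Ω' ψ u u ∧
      (IsCompact (closure Ω') → closure Ω' ⊆ Ω →
        MetricObstacle.IsBoundedObstacleSolution μ p Ω' ψ u u) := by
  have hμΩ' : μ Ω' ≠ 0 :=
    (MetricObstacle.measure_pos_of_isOpen (fun x r hr => (hμ x r hr).1) hΩ'_open hΩ'_ne).ne'
  have hμX : μ univ ≠ 0 := fun h => hμΩ' (measure_mono_null (subset_univ Ω') h)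
  have hsol := hu.restrict hp.le hμX hΩ'_open hΩ'_ne hΩ'
  refine ⟨hsol, fun hcomp hsub => ?_⟩
  -- The empty set has capacity zero. A point outside `Ω` serves as the second point that the local
  -- integrability argument needs.
  have hne : Ωᶜ.Nonempty := by
    rw [nonempty_iff_ne_empty]
    intro h
    have := hu.capacity_compl_pos
    rw [h, MetricObstacle.capacity_empty hp.le hμX] at this
    exact this.false
  obtain ⟨L, hL⟩ := hPI.localPoincare hμ (by linarith)
  refine hsol.isBounded hp.le (hcomp.isBounded.subset subset_closure) hμΩ' ?_
  exact (lintegral_mono_set subset_closure).trans_lt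
    (hu.mem.1.lintegral_abs_lt_top_of_isCompact hL hp.le hμ hu.isOpen hne hcomp hsub)
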